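/- **Theorem 1.10.** Let $k$ be a field of characteristic zero. A *Poisson algebra* is a commutative $k$-algebra $A$ with a $k$-bilinear Lie bracket $\{-,-\}$ that is a derivation in each variable. A *Poisson ideal* is an ideal $I$ with $\{A,I\}\subseteq I$; a *Poisson prime* is a prime ideal that is a Poisson ideal; the set $\operatorname{P.spec}A$ of Poisson primes carries the topology induced by the Zariski topology of $\operatorname{spec}A$. Let $A$ be a Poisson algebra, not necessarily a polynomial ring, on which a torus $H=(k^\times)^r$ ($r\ge 0$) acts by $k$-algebra automorphisms preserving the bracket. Assume that the action is *rational*, i.e. $A$ is generated as a $k$-algebra by $H$-eigenvectors whose eigenvalues are characters of the form $h\mapsto h^m:=h_1^{m_1}\cdots h_r^{m_r}$ with $m\in\mathbb Z^r$; then $A=\bigoplus_{m\in\mathbb Z^r}A_m$ with $A_m=\{a\in A\mid h.a=h^m a \text{ for all } h\in H\}$. The Lie algebra $\mathfrak h=\operatorname{Lie}H=k^r$ acts on $A$ by the differential of this action, i.e. linearly with $\eta.a=(\eta_1m_1+\cdots+\eta_rm_r)\,a$ for $\eta\in\mathfrak h$ and $a\in A_m$. Assume that $A$ is generated as a $k$-algebra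 by $H$-eigenvectors $x_1,\dots,x_n$ ($n\ge 0$), and that there exist $\eta_1,\dots,\eta_n\in\mathfrak h$ such that 1. $\{x_i,x_j\}-(\eta_i.x_j)x_i\in k\langle x_1,\dots,x_{i-1}\rangle$ for all $i>j$, where $k\langle x_1,\dots,x_{i-1}\rangle$ is the $k$-subalgebra of $A$ generated by $x_1,\dots,x_{i-1}$; 2. for all $i$, the $\eta_i$-eigenvalue of $x_i$ is nonzero. Then $A$ has at most $2^n$ $H$-stable Poisson primes, and $A$ satisfies the *Poisson Dixmier–Moeglin equivalence*, i.e. the following three sets coincide: * the set of Poisson primitive ideals of $A$, that is, of the ideals of the form: the largest Poisson ideal contained in $M$, for $M$ a maximal ideal of $A$; * the set of locally closed points of $\operatorname{P.spec}A$; * the set of Poisson rational ideals, that is, of the Poisson primes $P$ such that the field $\{z\in\operatorname{Fract}(A/P)\mid \{z,-\}=0\}$ is algebraic over $k$, for the unique extension to $\operatorname{Fract}(A/P)$ of the bracket induced on $A/P$. -/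

import Mathlib

/-!
Poisson algebras, Poisson primes, the Poisson Dixmier-Moeglin equivalence, rational torus actions
and the differential of a rational torus action.
-/

/-- A Poisson algebra over `k`: a commutative `k`-algebra with a `k`-bilinear Lie bracket which is
a derivation in the second variable (hence, by antisymmetry, in each variable). -/
class PoissonAlgebra (k A : Type*) [CommRing k] [CommRing A] [Algebra k A] where
  bracket : A →ₗ[k] A →ₗ[k] A
  bracket_self : ∀ a, bracket a a = 0
  jacobi : ∀ a b c,
    bracket a (bracket b c) + bracket b (bracket c a) + bracket c (bracket a b) = 0
  leibniz : ∀ a b c, bracket a (b * c) = bracket a b * c + b * bracket a c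

namespace PoissonAlgebra

section Basic

variable (k : Type*) {A : Type*} [CommRing k] [CommRing A] [Algebra k A] [PoissonAlgebra k A]

/-- The Poisson bracket `{a, b}`. -/
def pb (a b : A) : A := bracket (k := k) a b

theorem pb_self (a : A) : pb k a a = 0 := bracket_self a

theorem pb_skew (a b : A) : pb k a b = - pb k b a := by
  have h := pb_self k (a + b)
  simp only [pb, map_add, LinearMap.add_apply, bracket_self, zero_add, add_zero] at h ⊢
  exact eq_neg_of_add_eq_zero_right h

theorem pb_mul_right (a b c : A) : pb k a (b * c) = pb k a b * c + b * pb k a c :=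
  leibniz a b c

theorem pb_mul_left (a b c : A) : pb k (a * b) c = pb k a c * b + a * pb k b c := by
  rw [pb_skew, pb_mul_right, pb_skew k c a, pb_skew k c b]; ring

theorem pb_jacobi (a b c : A) :
    pb k a (pb k b c) + pb k b (pb k c a) + pb k c (pb k a b) = 0 := jacobi a b c

theorem pb_add_left (a b c : A) : pb k (a + b) c = pb k a c + pb k b c := by simp [pb]
theorem pb_add_right (a b c : A) : pb k a (b + c) = pb k a b + pb k a c := by simp [pb]
theorem pb_smul_left (r : k) (a b : A) : pb k (r • a) b = r • pb k a b := by simp [pb]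
theorem pb_smul_right (r : k) (a b : A) : pb k a (r • b) = r • pb k a b := by simp [pb]
theorem pb_sub_right (a b c : A) : pb k a (b - c) = pb k a b - pb k a c := by simp [pb]
theorem pb_sub_left (a b c : A) : pb k (a - b) c = pb k a c - pb k b c := by simp [pb]

theorem pb_algebraMap_right (a : A) (r : k) : pb k a (algebraMap k A r) = 0 := by
  have h := pb_mul_right k a 1 1
  simp only [mul_one, one_mul, left_eq_add] at h
  rw [Algebra.algebraMap_eq_smul_one, pb_smul_right, h, smul_zero]

/-- The Hamiltonian derivation `{a, -}`. -/
def ham (a : A) : Derivation k A A :=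
  Derivation.mk' (bracket (k := k) a) fun b c => by
    rw [leibniz]; simp only [smul_eq_mul]; ring

theorem ham_apply (a b : A) : ham k a b = pb k a b := rfl

/-- The Poisson center `{z | {z, -} = 0}`. -/
def center (k A : Type*) [CommRing k] [CommRing A] [Algebra k A] [PoissonAlgebra k A] :
    Subalgebra k A where
  carrier := {z | ∀ a : A, pb k z a = 0}
  mul_mem' := fun {x y} hx hy a => by rw [pb_mul_left, hx a, hy a]; ring
  add_mem' := fun {x y} hx hy a => by rw [pb_add_left, hx a, hy a, add_zero]
  algebraMap_mem' := fun r a => by rw [pb_skew, pb_algebraMap_right, neg_zero]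

/-- A Poisson ideal: an ideal `I` with `{A, I} ⊆ I`. -/
def IsPoissonIdeal (I : Ideal A) : Prop := ∀ a : A, ∀ b ∈ I, pb k a b ∈ I

/-- A Poisson prime ideal: a prime ideal which is also a Poisson ideal. -/
def IsPoissonPrime (P : Ideal A) : Prop := P.IsPrime ∧ IsPoissonIdeal k P

/-- The Poisson prime spectrum, with the topology induced from the Zariski topology
(the subtype topology). -/
abbrev PSpec (k A : Type*) [CommRing k] [CommRing A] [Algebra k A] [PoissonAlgebra k A] : Type _ :=
  {P : PrimeSpectrum A // IsPoissonIdeal k P.asIdeal}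

/-- The Poisson core of an ideal `J`: the largest Poisson ideal contained in `J`. -/
def core (J : Ideal A) : Ideal A := sSup {I | IsPoissonIdeal k I ∧ I ≤ J}

theorem isGreatest_core (J : Ideal A) :
    IsGreatest {I : Ideal A | IsPoissonIdeal k I ∧ I ≤ J} (core k J) := by
  refine ⟨⟨fun a b hb => ?_, sSup_le fun I hI => hI.2⟩, fun I hI => le_sSup hI⟩
  unfold core at hb ⊢
  rw [sSup_eq_iSup'] at hb ⊢
  refine Submodule.iSup_induction _ (motive := fun b => pb k a b ∈ _) hb ?_ ?_ ?_
  · intro I x hx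
    exact Submodule.mem_iSup_of_mem I (I.2.1 a x hx)
  · simp [pb]
  · intro x y hx hy
    rw [pb_add_right]; exact add_mem hx hy

/-- A Poisson primitive ideal: the Poisson core of a maximal ideal. -/
def IsPoissonPrimitive (P : Ideal A) : Prop := ∃ M : Ideal A, M.IsMaximal ∧ P = core k M

end Basic

section Quotient

theorem smul_mk {k A : Type*} [CommRing k] [CommRing A] [Algebra k A]
    (I : Ideal A) (r : k) (a : A) :
    r • Ideal.Quotient.mk I a = Ideal.Quotient.mk I (r • a) := rfl

variable {k A : Type*} [CommRing k] [CommRing A] [Algebra k A] [PoissonAlgebra k A]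

theorem IsPoissonIdeal.pb_sub_mem {I : Ideal A} (hI : IsPoissonIdeal k I) {a a' b b' : A}
    (ha : a - a' ∈ I) (hb : b - b' ∈ I) : pb k a b - pb k a' b' ∈ I := by
  have h1 : pb k a (b - b') ∈ I := hI a _ hb
  have h2 : pb k b' (a - a') ∈ I := hI b' _ ha
  rw [pb_skew, pb_sub_left] at h2
  rw [pb_sub_right] at h1
  have := add_mem h1 (neg_mem h2)
  convert this using 1
  ring

/-- The bracket of two classes modulo a Poisson ideal. -/
def quotientPb {I : Ideal A} (hI : IsPoissonIdeal k I) (x y : A ⧸ I) : A ⧸ I :=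
  Quotient.map₂ (pb k) (fun a a' ha b b' hb => by
    have ha' := (Submodule.quotientRel_def I).1 ha
    have hb' := (Submodule.quotientRel_def I).1 hb
    exact (Submodule.quotientRel_def I).2 (hI.pb_sub_mem ha' hb')) x y

theorem quotientPb_mk {I : Ideal A} (hI : IsPoissonIdeal k I) (a b : A) :
    quotientPb hI (Ideal.Quotient.mk I a) (Ideal.Quotient.mk I b) =
      Ideal.Quotient.mk I (pb k a b) := rfl

/-- The induced Poisson bracket on the quotient by a Poisson ideal, `{ā, b̄} = class of {a, b}`. -/
@[reducible] def quotient {I : Ideal A} (hI : IsPoissonIdeal k I) : PoissonAlgebra k (A ⧸ I) where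
  bracket := LinearMap.mk₂ k (quotientPb hI)
    (fun x y z => by
      obtain ⟨a, rfl⟩ := Ideal.Quotient.mk_surjective x
      obtain ⟨b, rfl⟩ := Ideal.Quotient.mk_surjective y
      obtain ⟨c, rfl⟩ := Ideal.Quotient.mk_surjective z
      simp only [quotientPb_mk, ← map_add, pb_add_left])
    (fun r x y => by
      obtain ⟨a, rfl⟩ := Ideal.Quotient.mk_surjective x
      obtain ⟨b, rfl⟩ := Ideal.Quotient.mk_surjective y
      simp only [quotientPb_mk, smul_mk, pb_smul_left])
    (fun x y z => by
      obtain ⟨a, rfl⟩ := Ideal.Quotient.mk_surjective x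
      obtain ⟨b, rfl⟩ := Ideal.Quotient.mk_surjective y
      obtain ⟨c, rfl⟩ := Ideal.Quotient.mk_surjective z
      simp only [quotientPb_mk, ← map_add, pb_add_right])
    (fun r x y => by
      obtain ⟨a, rfl⟩ := Ideal.Quotient.mk_surjective x
      obtain ⟨b, rfl⟩ := Ideal.Quotient.mk_surjective y
      simp only [quotientPb_mk, smul_mk, pb_smul_right])
  bracket_self := fun x => by
    obtain ⟨a, rfl⟩ := Ideal.Quotient.mk_surjective x
    simp only [LinearMap.mk₂_apply, quotientPb_mk, pb_self, map_zero]
  jacobi := fun x y z => by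
    obtain ⟨a, rfl⟩ := Ideal.Quotient.mk_surjective x
    obtain ⟨b, rfl⟩ := Ideal.Quotient.mk_surjective y
    obtain ⟨c, rfl⟩ := Ideal.Quotient.mk_surjective z
    simp only [LinearMap.mk₂_apply, quotientPb_mk, ← map_add, pb_jacobi, map_zero]
  leibniz := fun x y z => by
    obtain ⟨a, rfl⟩ := Ideal.Quotient.mk_surjective x
    obtain ⟨b, rfl⟩ := Ideal.Quotient.mk_surjective y
    obtain ⟨c, rfl⟩ := Ideal.Quotient.mk_surjective z
    simp only [LinearMap.mk₂_apply, quotientPb_mk, ← map_add, ← map_mul, pb_mul_right]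

theorem quotient_pb_mk {I : Ideal A} (hI : IsPoissonIdeal k I) (a b : A) :
    letI := quotient hI
    pb k (Ideal.Quotient.mk I a) (Ideal.Quotient.mk I b) = Ideal.Quotient.mk I (pb k a b) := rfl

end Quotient

section Fraction

variable {k R : Type*} [Field k] [CommRing R] [IsDomain R] [Algebra k R]

section Lift

variable {M : Type*} [AddCommGroup M] [Module k M] [Module R M] [Module (FractionRing R) M]
  [IsScalarTower k R M] [IsScalarTower R (FractionRing R) M] [IsScalarTower k (FractionRing R) M]

/-- Two derivations of a quotient field which agree on the domain are equal. -/
theorem fraction_derivation_ext {D E : Derivation k (FractionRing R) M}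
    (h : ∀ a : R, D (algebraMap R (FractionRing R) a) = E (algebraMap R (FractionRing R) a)) :
    D = E := by
  ext z
  obtain ⟨a, s, hs, rfl⟩ := IsFractionRing.div_surjective (A := R) z
  have hs0 : algebraMap R (FractionRing R) s ≠ 0 :=
    IsFractionRing.to_map_ne_zero_of_mem_nonZeroDivisors hs
  have key : ∀ F : Derivation k (FractionRing R) M,
      algebraMap R (FractionRing R) s •
        F (algebraMap R (FractionRing R) a / algebraMap R (FractionRing R) s) =
      F (algebraMap R (FractionRing R) a) -
        (algebraMap R (FractionRing R) a / algebraMap R (FractionRing R) s) •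
          F (algebraMap R (FractionRing R) s) := by
    intro F
    have h1 := F.leibniz (algebraMap R (FractionRing R) s)
      (algebraMap R (FractionRing R) a / algebraMap R (FractionRing R) s)
    rw [mul_div_cancel₀ _ hs0] at h1
    rw [h1]; abel
  have h2 : algebraMap R (FractionRing R) s •
        D (algebraMap R (FractionRing R) a / algebraMap R (FractionRing R) s) =
      algebraMap R (FractionRing R) s •
        E (algebraMap R (FractionRing R) a / algebraMap R (FractionRing R) s) := by
    rw [key, key, h, h]
  exact smul_right_injective M hs0 h2

/-- The unique extension of a derivation of a domain, with values in a vector space over the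
quotient field, to the quotient field. -/
noncomputable def liftDerivation (D : Derivation k R M) : Derivation k (FractionRing R) M :=
  haveI : Algebra.FormallyEtale R (FractionRing R) :=
    Algebra.FormallyEtale.of_isLocalization (nonZeroDivisors R)
  ((KaehlerDifferential.isBaseChange_of_formallyEtale k R (FractionRing R)).lift
    D.liftKaehlerDifferential).compDer (KaehlerDifferential.D k (FractionRing R))

theorem liftDerivation_algebraMap (D : Derivation k R M) (a : R) :
    liftDerivation D (algebraMap R (FractionRing R) a) = D a := by
  have : Algebra.FormallyEtale R (FractionRing R) :=
    Algebra.FormallyEtale.of_isLocalization (nonZeroDivisors R)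
  have h := (KaehlerDifferential.isBaseChange_of_formallyEtale k R (FractionRing R)).lift_eq
    D.liftKaehlerDifferential (KaehlerDifferential.D k R a)
  rw [KaehlerDifferential.map_D, Derivation.liftKaehlerDifferential_comp_D] at h
  exact h

end Lift

variable [PoissonAlgebra k R]

/-- For `a` in the domain, the extension of `{a, -}` to the quotient field; this is a derivation
in `a`. -/
noncomputable def fractionHam :
    Derivation k R (Derivation k (FractionRing R) (FractionRing R)) :=
  Derivation.mk'
    { toFun := fun a => liftDerivation ((Algebra.linearMap R (FractionRing R)).compDer (ham k a))
      map_add' := fun a b => fraction_derivation_ext fun c => by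
        simp [liftDerivation_algebraMap, ham_apply, pb_add_left]
      map_smul' := fun r a => fraction_derivation_ext fun c => by
        simp [liftDerivation_algebraMap, ham_apply, pb_smul_left] }
    fun a b => fraction_derivation_ext fun c => by
      simp [liftDerivation_algebraMap, ham_apply, pb_mul_left, Algebra.smul_def]
      ring

theorem fractionHam_apply (a b : R) :
    fractionHam (k := k) a (algebraMap R (FractionRing R) b) =
      algebraMap R (FractionRing R) (pb k a b) :=
  liftDerivation_algebraMap _ b

/-- The extension of the bracket to the quotient field, as a biderivation. -/
noncomputable def fractionBi :
    Derivation k (FractionRing R) (Derivation k (FractionRing R) (FractionRing R)) :=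
  liftDerivation (fractionHam (k := k) (R := R))

theorem fractionBi_algebraMap (a b : R) :
    fractionBi (k := k) (algebraMap R (FractionRing R) a) (algebraMap R (FractionRing R) b) =
      algebraMap R (FractionRing R) (pb k a b) := by
  rw [fractionBi, liftDerivation_algebraMap, fractionHam_apply]

theorem fractionBi_skew (u v : FractionRing R) :
    fractionBi (k := k) u v = - fractionBi (k := k) v u := by
  -- evaluation at a point, as a linear map on derivations
  let ev : FractionRing R →
      (Derivation k (FractionRing R) (FractionRing R) →ₗ[FractionRing R] FractionRing R) :=
    fun w => { toFun := fun D => D w, map_add' := fun _ _ => rfl, map_smul' := fun _ _ => rfl }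
  have h1 : ∀ (a : R) (v : FractionRing R),
      fractionBi (k := k) (algebraMap R (FractionRing R) a) v =
        - fractionBi (k := k) v (algebraMap R (FractionRing R) a) := by
    intro a v
    have : fractionBi (k := k) (algebraMap R (FractionRing R) a) =
        - (ev (algebraMap R (FractionRing R) a)).compDer (fractionBi (k := k)) := by
      refine fraction_derivation_ext fun b => ?_
      change fractionBi (k := k) (algebraMap R (FractionRing R) a) (algebraMap R _ b) =
        - fractionBi (k := k) (algebraMap R _ b) (algebraMap R (FractionRing R) a)
      rw [fractionBi_algebraMap, fractionBi_algebraMap, pb_skew, map_neg]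
    exact congrArg (fun D => D v) this
  have : fractionBi (k := k) u = - (ev u).compDer (fractionBi (k := k)) := by
    refine fraction_derivation_ext fun b => ?_
    change fractionBi (k := k) u (algebraMap R _ b) = - fractionBi (k := k) (algebraMap R _ b) u
    rw [h1, neg_neg]
  exact congrArg (fun D => D v) this

theorem fractionBi_self (w : FractionRing R) : fractionBi (k := k) w w = 0 := by
  obtain ⟨a, s, hs, rfl⟩ := IsFractionRing.div_surjective (A := R) w
  have hs0 : algebraMap R (FractionRing R) s ≠ 0 :=
    IsFractionRing.to_map_ne_zero_of_mem_nonZeroDivisors hs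
  set S := algebraMap R (FractionRing R) s with hS
  set w := algebraMap R (FractionRing R) a / S with hw
  have ha : algebraMap R (FractionRing R) a = S * w := by rw [hw, mul_div_cancel₀ _ hs0]
  have h1 : fractionBi (k := k) (S * w) (S * w) = 0 := by
    rw [← ha, fractionBi_algebraMap, pb_self, map_zero]
  have h2 : fractionBi (k := k) S S = 0 := by rw [hS, fractionBi_algebraMap, pb_self, map_zero]
  have h3 := fractionBi_skew (k := k) S w
  simp only [Derivation.leibniz, Derivation.add_apply, Derivation.smul_apply, smul_eq_mul, h2,
    h3] at h1
  have h4 : S * S * fractionBi (k := k) w w = 0 := by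
    rw [← h1]; ring
  exact (mul_eq_zero.1 h4).resolve_left (mul_ne_zero hs0 hs0)

theorem fractionBi_jacobi (u v w : FractionRing R) :
    fractionBi (k := k) u (fractionBi (k := k) v w) +
      fractionBi (k := k) v (fractionBi (k := k) w u) +
      fractionBi (k := k) w (fractionBi (k := k) u v) = 0 := by
  have aux : ∀ u v : FractionRing R,
      (∀ c : R, fractionBi (k := k) u (fractionBi (k := k) v (algebraMap R _ c)) +
        fractionBi (k := k) v (fractionBi (k := k) (algebraMap R _ c) u) +
        fractionBi (k := k) (algebraMap R _ c) (fractionBi (k := k) u v) = 0) →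
      ∀ w, fractionBi (k := k) u (fractionBi (k := k) v w) +
        fractionBi (k := k) v (fractionBi (k := k) w u) +
        fractionBi (k := k) w (fractionBi (k := k) u v) = 0 := by
    intro u v h w
    have e : ⁅fractionBi (k := k) u, fractionBi (k := k) v⁆ =
        fractionBi (k := k) (fractionBi (k := k) u v) := by
      refine fraction_derivation_ext fun c => ?_
      have hc := h c
      rw [fractionBi_skew (algebraMap R _ c) u, fractionBi_skew (algebraMap R _ c), map_neg] at hc
      rw [Derivation.commutator_apply]
      linear_combination hc
    have e' := congrArg (fun D => D w) e
    simp only [Derivation.commutator_apply] at e'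
    rw [fractionBi_skew w u, fractionBi_skew w, map_neg]
    linear_combination e'
  have h1 : ∀ (a b : R) (w : FractionRing R), _ := fun a b => aux (algebraMap R _ a)
    (algebraMap R _ b) fun c => by
      simp only [fractionBi_algebraMap, ← map_add, pb_jacobi, map_zero]
  have h2 : ∀ (a : R) (v w : FractionRing R), _ := fun a v => aux (algebraMap R _ a) v fun c => by
    have := h1 c a v
    linear_combination this
  refine aux u v (fun c => ?_) w
  have := h2 c u v
  linear_combination this

/-- The unique extension of a Poisson bracket on a domain to the quotient field. -/
@[reducible] noncomputable def fractionRing (k R : Type*) [Field k] [CommRing R] [IsDomain R]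
    [Algebra k R] [PoissonAlgebra k R] : PoissonAlgebra k (FractionRing R) where
  bracket := LinearMap.mk₂ k (fun u v => fractionBi (k := k) u v)
    (fun u v w => by rw [map_add, Derivation.add_apply])
    (fun r u v => by rw [Derivation.map_smul, Derivation.smul_apply])
    (fun u v w => by rw [map_add])
    (fun r u v => by rw [Derivation.map_smul])
  bracket_self := fun u => fractionBi_self u
  jacobi := fun u v w => fractionBi_jacobi u v w
  leibniz := fun u v w => by
    simp only [LinearMap.mk₂_apply, Derivation.leibniz, smul_eq_mul]; ring

theorem fractionRing_pb_algebraMap (a b : R) :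
    letI := fractionRing k R
    pb k (algebraMap R (FractionRing R) a) (algebraMap R (FractionRing R) b) =
      algebraMap R (FractionRing R) (pb k a b) := fractionBi_algebraMap a b

theorem fractionRing_unique (E : PoissonAlgebra k (FractionRing R))
    (hE : ∀ a b : R, E.bracket (algebraMap R (FractionRing R) a)
      (algebraMap R (FractionRing R) b) = algebraMap R (FractionRing R) (pb k a b))
    (u v : FractionRing R) : E.bracket u v = (fractionRing k R).bracket u v := by
  have step : ∀ w : FractionRing R,
      (∀ b : R, E.bracket w (algebraMap R _ b) = fractionBi (k := k) w (algebraMap R _ b)) →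
      ∀ v, E.bracket w v = fractionBi (k := k) w v := by
    intro w h v
    have : @ham k _ _ _ _ E w = fractionBi (k := k) w := fraction_derivation_ext h
    exact congrArg (fun D => D v) this
  refine step u (fun b => ?_) v
  have h1 := step (algebraMap R _ b) (fun c => by rw [hE, fractionBi_algebraMap]) u
  have h2 := @pb_skew k _ _ _ _ E u (algebraMap R _ b)
  rw [fractionBi_skew, ← h1]
  exact h2

end Fraction

section DixmierMoeglin

variable (k : Type*) {A : Type*} [Field k] [CommRing A] [Algebra k A] [PoissonAlgebra k A]

/-- The field `Z_p(Fract A/P)`: the Poisson center of the quotient field of `A/P`. -/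
noncomputable def fractCenter (P : Ideal A) [P.IsPrime] (hP : IsPoissonIdeal k P) :
    Subalgebra k (FractionRing (A ⧸ P)) :=
  letI : PoissonAlgebra k (A ⧸ P) := quotient hP
  letI : PoissonAlgebra k (FractionRing (A ⧸ P)) := fractionRing k (A ⧸ P)
  center k (FractionRing (A ⧸ P))

/-- A Poisson rational Poisson prime: `Z_p(Fract A/P)` is algebraic over `k`. -/
def IsPoissonRational (P : Ideal A) : Prop :=
  ∃ (_ : P.IsPrime) (hP : IsPoissonIdeal k P), (fractCenter k P hP).IsAlgebraic

/-- The ideal `P` is a Poisson prime and a locally closed point of the Poisson prime spectrum. -/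
def IsLocallyClosedPoint (P : Ideal A) : Prop :=
  ∃ Q : PSpec k A, Q.1.asIdeal = P ∧ IsLocallyClosed ({Q} : Set (PSpec k A))

/-- The Poisson Dixmier-Moeglin equivalence: the Poisson primitive ideals, the locally closed
points of the Poisson prime spectrum and the Poisson rational Poisson primes coincide. -/
def DixmierMoeglin (k A : Type*) [Field k] [CommRing A] [Algebra k A] [PoissonAlgebra k A] :
    Prop :=
  {P : Ideal A | IsPoissonPrimitive k P} = {P : Ideal A | IsLocallyClosedPoint k P} ∧
    {P : Ideal A | IsLocallyClosedPoint k P} = {P : Ideal A | IsPoissonRational k P}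

end DixmierMoeglin

end PoissonAlgebra

namespace TorusAction

variable {k A : Type*} [Field k] [CommRing A] [Algebra k A] {r : ℕ}

/-- The rational character `h ↦ h₁ ^ m₁ ⋯ h_r ^ m_r` of the torus `(k^×)^r`. -/
def character (k : Type*) [Field k] {r : ℕ} (m : Fin r → ℤ) : (Fin r → kˣ) →* kˣ where
  toFun h := ∏ l, h l ^ m l
  map_one' := by simp
  map_mul' g h := by simp [mul_zpow, Finset.prod_mul_distrib]

/-- The eigenspace `A_m` of the character `m`. -/
def weightSpace (ρ : (Fin r → kˣ) →* (A ≃ₐ[k] A)) (m : Fin r → ℤ) : Submodule k A where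
  carrier := {a | ∀ h, ρ h a = (character k m h : k) • a}
  add_mem' := fun {a b} ha hb h => by rw [map_add, ha h, hb h, smul_add]
  zero_mem' := fun h => by simp
  smul_mem' := fun c a ha h => by rw [map_smul, ha h, smul_comm]

/-- An action of the torus `(k^×)^r` on `A` by algebra automorphisms is rational if `A` is
generated as an algebra by eigenvectors whose eigenvalues are rational characters. -/
def IsRational (ρ : (Fin r → kˣ) →* (A ≃ₐ[k] A)) : Prop :=
  Algebra.adjoin k {a : A | ∃ m : Fin r → ℤ, a ∈ weightSpace ρ m} = ⊤

/-- The action is by Poisson automorphisms. -/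
def IsPoisson [PoissonAlgebra k A] (ρ : (Fin r → kˣ) →* (A ≃ₐ[k] A)) : Prop :=
  ∀ h a b, ρ h (PoissonAlgebra.pb k a b) = PoissonAlgebra.pb k (ρ h a) (ρ h b)

/-- An `H`-eigenvector: an element which is an eigenvector of every element of `H`. -/
def IsEigenvector (ρ : (Fin r → kˣ) →* (A ≃ₐ[k] A)) (x : A) : Prop :=
  ∀ h, ∃ c : k, Module.End.HasEigenvector (ρ h).toLinearMap c x

/-- An ideal `I` is `H`-stable if `h(I) ⊆ I` for all `h ∈ H`. -/
def IsStable (ρ : (Fin r → kˣ) →* (A ≃ₐ[k] A)) (I : Ideal A) : Prop :=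
  ∀ h, ∀ a ∈ I, ρ h a ∈ I

theorem weightSpace_mul_mem (ρ : (Fin r → kˣ) →* (A ≃ₐ[k] A)) {m m' : Fin r → ℤ} {a b : A}
    (ha : a ∈ weightSpace ρ m) (hb : b ∈ weightSpace ρ m') :
    a * b ∈ weightSpace ρ (m + m') := by
  intro h
  have e : character k (m + m') h = character k m h * character k m' h := by
    simp [character, zpow_add, Finset.prod_mul_distrib]
  rw [map_mul, ha h, hb h, e, Units.val_mul, smul_mul_smul_comm]

theorem one_mem_weightSpace (ρ : (Fin r → kˣ) →* (A ≃ₐ[k] A)) :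
    (1 : A) ∈ weightSpace ρ 0 := fun h => by simp [character]

theorem iSup_weightSpace {ρ : (Fin r → kˣ) →* (A ≃ₐ[k] A)} (hρ : IsRational ρ) :
    ⨆ m, weightSpace ρ m = ⊤ := by
  rw [eq_top_iff]
  intro a _
  have ha : a ∈ Algebra.adjoin k {a : A | ∃ m : Fin r → ℤ, a ∈ weightSpace ρ m} := by
    rw [hρ]; trivial
  induction ha using Algebra.adjoin_induction with
  | mem x hx =>
    obtain ⟨m, hm⟩ := hx
    exact Submodule.mem_iSup_of_mem m hm
  | algebraMap c =>
    rw [Algebra.algebraMap_eq_smul_one]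
    exact Submodule.mem_iSup_of_mem 0 (Submodule.smul_mem _ c (one_mem_weightSpace ρ))
  | add x y _ _ hx hy => exact add_mem (hx trivial) (hy trivial)
  | mul x y _ _ hx hy =>
    refine Submodule.iSup_induction _ (motive := fun x => x * y ∈ _) (hx trivial) ?_ ?_ ?_
    · intro m x hx
      refine Submodule.iSup_induction _ (motive := fun y => x * y ∈ _) (hy trivial) ?_ ?_ ?_
      · intro m' y hy
        exact Submodule.mem_iSup_of_mem (m + m') (weightSpace_mul_mem ρ hx hy)
      · simp
      · intro y z hy hz
        rw [mul_add]; exact add_mem hy hz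
    · simp
    · intro x z hx hz
      rw [add_mul]; exact add_mem hx hz

theorem character_injective (k : Type*) [Field k] [CharZero k] {r : ℕ} :
    Function.Injective fun (m : Fin r → ℤ) (h : Fin r → kˣ) => (character k m h : k) := by
  intro m m' e
  ext l
  have h2 : (2 : k) ≠ 0 := two_ne_zero
  have e' := congrFun e (Pi.mulSingle l (Units.mk0 (2 : k) h2))
  have key : ∀ n : Fin r → ℤ,
      character k n (Pi.mulSingle l (Units.mk0 (2 : k) h2)) = Units.mk0 (2 : k) h2 ^ n l := by
    intro n
    change ∏ j : Fin r, (Pi.mulSingle l (Units.mk0 (2 : k) h2) : Fin r → kˣ) j ^ n j = _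
    rw [Finset.prod_eq_single l]
    · simp
    · intro j _ hj
      simp [Pi.mulSingle_eq_of_ne hj]
    · simp
  simp only [key, Units.val_zpow_eq_zpow_val, Units.val_mk0] at e'
  have e'' : (2 : ℚ) ^ m l = (2 : ℚ) ^ m' l := by
    have : ((((2 : ℚ) ^ m l : ℚ)) : k) = (((2 : ℚ) ^ m' l : ℚ) : k) := by
      push_cast; exact e'
    exact_mod_cast this
  exact zpow_right_injective₀ (by norm_num) (by norm_num) e''

theorem iSupIndep_weightSpace [CharZero k] (ρ : (Fin r → kˣ) →* (A ≃ₐ[k] A)) :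
    iSupIndep (weightSpace ρ) := by
  have h1 := Module.End.independent_iInf_maxGenEigenspace_of_forall_mapsTo
    (fun h : Fin r → kˣ => ((ρ h).toLinearMap : Module.End k A)) (fun i j φ => by
      refine Module.End.mapsTo_maxGenEigenspace_of_comm ?_ φ
      change (ρ j).toLinearMap ∘ₗ (ρ i).toLinearMap = (ρ i).toLinearMap ∘ₗ (ρ j).toLinearMap
      ext a
      change (ρ j * ρ i) a = (ρ i * ρ j) a
      rw [← map_mul, ← map_mul, mul_comm])
  refine (h1.comp (character_injective k (r := r))).mono fun m a ha => ?_
  simp only [Function.comp, Submodule.mem_iInf]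
  intro h
  refine Module.End.mem_maxGenEigenspace _ _ _ |>.2 ⟨1, ?_⟩
  simp [ha h]

theorem isInternal_weightSpace [CharZero k] {ρ : (Fin r → kˣ) →* (A ≃ₐ[k] A)}
    (hρ : IsRational ρ) : DirectSum.IsInternal (weightSpace ρ) :=
  DirectSum.isInternal_submodule_of_iSupIndep_of_iSup_eq_top (iSupIndep_weightSpace ρ)
    (iSup_weightSpace hρ)

/-- The differential of a rational action of `H = (k^×)^r`: the element `η` of
`Lie H = k^r` acts on `A = ⨁ A_m` as multiplication by `(η | m) = η₁ m₁ + ⋯ + η_r m_r`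
on the eigenspace `A_m`. -/
noncomputable def differential [CharZero k] {ρ : (Fin r → kˣ) →* (A ≃ₐ[k] A)}
    (hρ : IsRational ρ) (η : Fin r → k) : Module.End k A :=
  DirectSum.toModule k (Fin r → ℤ) A
      (fun m => (∑ l, η l * (m l : k)) • (weightSpace ρ m).subtype) ∘ₗ
    (LinearEquiv.ofBijective (DirectSum.coeLinearMap (weightSpace ρ))
      (isInternal_weightSpace hρ)).symm.toLinearMap

theorem differential_apply [CharZero k] {ρ : (Fin r → kˣ) →* (A ≃ₐ[k] A)}
    (hρ : IsRational ρ) (η : Fin r → k) {m : Fin r → ℤ} {a : A} (ha : a ∈ weightSpace ρ m) :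
    differential hρ η a = (∑ l, η l * (m l : k)) • a := by
  have e : (LinearEquiv.ofBijective (DirectSum.coeLinearMap (weightSpace ρ))
      (isInternal_weightSpace hρ)).symm a =
      DirectSum.lof k (Fin r → ℤ) (fun m => weightSpace ρ m) m ⟨a, ha⟩ := by
    rw [LinearEquiv.symm_apply_eq]
    exact (DirectSum.coeLinearMap_lof (weightSpace ρ) m ⟨a, ha⟩).symm
  change DirectSum.toModule k (Fin r → ℤ) A _ _ = _
  rw [LinearEquiv.coe_coe, e, DirectSum.toModule_lof]
  rfl

end TorusAction

/-! ### Weights of a rational torus action, and stable primes. -/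

namespace TorusAction

variable {k A : Type*} [Field k] [CommRing A] [Algebra k A] {r : ℕ}
  {ρ : (Fin r → kˣ) →* (A ≃ₐ[k] A)}

/-! Two facts are combined: a bound for the number of `H`-stable Poisson primes, and the principle
that for an affine Poisson algebra with a rational torus action the finiteness of this number
implies the equivalence (`dixmierMoeglin_of_finite`).

The bound. Let R_i be the subalgebra generated by the x_l with l < i, and D_i the derivation by
which η_i acts. An `H`-stable ideal is stable under all D_i, and condition 1 makes x_i a Poisson-Ore
variable: {x_i, r} - D_i(r) x_i lies in R_i for r in R_i. Modulo a stable Poisson prime P, either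
x_i is a fraction of elements of R_i or it is transcendental over R_i
(`exists_mul_sub_mem_or_transcendental`). In the transcendental case P ∩ R_{i+1} consists of the
polynomials in x_i with coefficients in P ∩ R_i; otherwise the fraction is determined by P ∩ R_i
(`mul_sub_mem_of_mul_sub_mem`). By induction P is determined by the set of indices i of the first
kind, a subset of an n-element set.

Both lemmas rest on one computation: if δ is in the field in question, {δ, r} = D(r) δ for all r in
that field and D(δ) = c δ with c ≠ 0, then r = δ gives 0 = {δ, δ} = c δ², so δ = 0.

The equivalence. Locally closed implies primitive, because A is a Jacobson ring and Poisson cores of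
primes are prime in characteristic zero. Primitive implies rational, because a central fraction can
be evaluated at the maximal ideal (`isAlgebraic_of_central`). For rational implies locally closed, a
Poisson prime Q above the rational prime P either contains a stable Poisson prime not inside P, and
one element outside P lies in all of these finitely many primes, or has the same homogeneous
elements as P; then Q = P by `sum_mem_of_isPoissonRational`. -/

theorem pb_mem_weightSpace [PoissonAlgebra k A] (hpois : IsPoisson ρ) {m m' : Fin r → ℤ} {a b : A}
    (ha : a ∈ weightSpace ρ m) (hb : b ∈ weightSpace ρ m') :
    PoissonAlgebra.pb k a b ∈ weightSpace ρ (m + m') := by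
  intro h
  have e : character k (m + m') h = character k m h * character k m' h := by
    simp [character, zpow_add, Finset.prod_mul_distrib]
  rw [hpois, ha h, hb h, e, Units.val_mul, PoissonAlgebra.pb_smul_left,
    PoissonAlgebra.pb_smul_right, smul_smul]

theorem exists_sum_eq (hrat : IsRational ρ) (a : A) :
    ∃ (s : Finset (Fin r → ℤ)) (c : (Fin r → ℤ) → A),
      (∀ m, c m ∈ weightSpace ρ m) ∧ a = ∑ m ∈ s, c m := by
  have ha : a ∈ ⨆ m, weightSpace ρ m := by rw [iSup_weightSpace hrat]; trivial
  obtain ⟨f, hf, rfl⟩ := (Submodule.mem_iSup_iff_exists_finsupp _ _).1 ha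
  exact ⟨f.support, f, hf, rfl⟩

/-- In an algebra graded by a linearly ordered monoid, a prime ideal contains a homogeneous prime
ideal with the same homogeneous elements. -/
theorem exists_homogeneous_prime {ι : Type*} [AddCommMonoid ι] [LinearOrder ι]
    [IsOrderedCancelAddMonoid ι] (𝒜 : ι → Submodule k A) [SetLike.GradedMonoid 𝒜]
    (hind : iSupIndep 𝒜) (hsup : ⨆ i, 𝒜 i = ⊤) {P : Ideal A} (hP : P.IsPrime) :
    ∃ J : Ideal A, J.IsPrime ∧ J ≤ P ∧ (∀ i, ∀ a ∈ 𝒜 i, a ∈ P → a ∈ J) ∧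
      ∀ a ∈ J, ∃ (s : Finset ι) (c : ι → A), (∀ i, c i ∈ 𝒜 i ∧ c i ∈ J) ∧ a = ∑ i ∈ s, c i := by
  have _ : ∀ (i) (x : 𝒜 i), Decidable (x ≠ 0) := fun _ _ => Classical.dec _
  let _ : DirectSum.Decomposition 𝒜 :=
    (DirectSum.isInternal_submodule_of_iSupIndep_of_iSup_eq_top hind hsup).chooseDecomposition
  let _ : GradedAlgebra 𝒜 := { }
  exact ⟨(P.homogeneousCore 𝒜).toIdeal, hP.homogeneousCore, Ideal.toIdeal_homogeneousCore_le 𝒜 P,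
    fun i a ha haP => Ideal.mem_homogeneousCore_of_homogeneous_of_mem ⟨i, ha⟩ haP,
    fun a ha => ⟨(DirectSum.decompose 𝒜 a).support, fun i => DirectSum.decompose 𝒜 a i,
      fun i => ⟨(DirectSum.decompose 𝒜 a i).2, (P.homogeneousCore 𝒜).isHomogeneous i ha⟩,
      (DirectSum.sum_support_decompose 𝒜 a).symm⟩⟩

variable [CharZero k]

/-- A subspace stable under the torus contains the homogeneous components of its elements. -/
theorem mem_of_sum_mem {W : Submodule k A} (hW : ∀ h, ∀ a ∈ W, ρ h a ∈ W)
    (s : Finset (Fin r → ℤ)) : ∀ a : (Fin r → ℤ) → A, (∀ m ∈ s, a m ∈ weightSpace ρ m) →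
      ∑ m ∈ s, a m ∈ W → ∀ m ∈ s, a m ∈ W := by
  classical
  induction s using Finset.strongInduction with
  | H s ih =>
    intro a ha hs m hm
    by_cases hm' : ∃ m' ∈ s, m' ≠ m
    · obtain ⟨m', hm's, hne⟩ := hm'
      obtain ⟨h, hh⟩ : ∃ h, (character k m h : k) ≠ character k m' h := by
        by_contra! hcon
        exact hne (character_injective k (funext hcon)).symm
      -- The operator `ρ h - character k m' h` kills the component of weight `m'` and multiplies
      -- that of weight `m` by a nonzero scalar.
      have key := ih (s.erase m') (Finset.erase_ssubset hm's)
        (fun l => ((character k l h : k) - character k m' h) • a l)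
        (fun l hl => Submodule.smul_mem _ _ (ha l (Finset.mem_of_mem_erase hl))) ?_ m
        (Finset.mem_erase.2 ⟨hne.symm, hm⟩)
      · exact (W.smul_mem_iff (sub_ne_zero.2 hh)).1 key
      · have h1 := W.sub_mem (hW h _ hs) (W.smul_mem (character k m' h : k) hs)
        rw [map_sum, Finset.smul_sum, ← Finset.sum_sub_distrib, ← Finset.add_sum_erase _ _ hm's,
          ha m' hm's h, sub_self, zero_add] at h1
        convert h1 using 1
        refine Finset.sum_congr rfl fun l hl => ?_
        rw [sub_smul, ha l (Finset.mem_of_mem_erase hl) h]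
    · push Not at hm'
      have : s = {m} := Finset.eq_singleton_iff_unique_mem.2 ⟨hm, hm'⟩
      rwa [this, Finset.sum_singleton] at hs

/-- The differential of a rational action satisfies the Leibniz rule. -/
theorem differential_mul (hrat : IsRational ρ) (η : Fin r → k) (a b : A) :
    differential hrat η (a * b) = a * differential hrat η b + b * differential hrat η a := by
  obtain ⟨s, c, hc, rfl⟩ := exists_sum_eq hrat a
  obtain ⟨t, d, hd, rfl⟩ := exists_sum_eq hrat b
  rw [mul_comm (∑ m ∈ t, d m)]
  simp only [Finset.sum_mul_sum, map_sum, ← Finset.sum_add_distrib]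
  refine Finset.sum_congr rfl fun m _ => Finset.sum_congr rfl fun m' _ => ?_
  rw [differential_apply hrat η (weightSpace_mul_mem ρ (hc m) (hd m')),
    differential_apply hrat η (hc m), differential_apply hrat η (hd m')]
  simp only [Pi.add_apply, Int.cast_add, mul_add, Finset.sum_add_distrib, add_smul,
    mul_smul_comm, smul_mul_assoc]
  rw [add_comm]

/-- The differential of a rational action, as a derivation. -/
noncomputable def differentialDer (hrat : IsRational ρ) (η : Fin r → k) : Derivation k A A :=
  Derivation.mk' (differential hrat η) (differential_mul hrat η)

/-- Stable ideals are spanned by their homogeneous elements, on which the differential is scalar.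
Only this infinitesimal stability enters the count. -/
theorem IsStable.differential_mem {I : Ideal A} (hI : IsStable ρ I) (hrat : IsRational ρ)
    (η : Fin r → k) {a : A} (ha : a ∈ I) : differential hrat η a ∈ I := by
  obtain ⟨s, c, hc, rfl⟩ := exists_sum_eq hrat a
  have h := mem_of_sum_mem (W := I.restrictScalars k) hI s c (fun m _ => hc m) ha
  rw [map_sum]
  refine sum_mem fun m hm => ?_
  rw [differential_apply hrat η (hc m)]
  exact (I.restrictScalars k).smul_mem _ (h m hm)

/-- Every Poisson prime contains a torus-stable Poisson prime with the same homogeneous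
elements. -/
theorem exists_stable_poissonPrime [PoissonAlgebra k A] (hrat : IsRational ρ)
    (hpois : IsPoisson ρ) {P : Ideal A} (hP : PoissonAlgebra.IsPoissonPrime k P) :
    ∃ J : Ideal A, PoissonAlgebra.IsPoissonPrime k J ∧ IsStable ρ J ∧ J ≤ P ∧
      ∀ m, ∀ a ∈ weightSpace ρ m, a ∈ P → a ∈ J := by
  -- The primality of the homogeneous part needs a linear order on the weights; the lexicographic
  -- order on ℤ^r serves.
  have : SetLike.GradedMonoid (fun m : Lex (Fin r → ℤ) => weightSpace ρ (ofLex m)) :=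
    { one_mem := one_mem_weightSpace ρ
      mul_mem := fun i j a b ha hb => weightSpace_mul_mem ρ ha hb }
  obtain ⟨J, hJ, hle, hmem, hcomp⟩ := exists_homogeneous_prime
    (fun m : Lex (Fin r → ℤ) => weightSpace ρ (ofLex m))
    (iSupIndep_weightSpace ρ) (iSup_weightSpace hrat) hP.1
  refine ⟨J, ⟨hJ, fun a b hb => ?_⟩, fun h a ha => ?_, hle, fun m => hmem (toLex m)⟩
  · obtain ⟨s, c, hc, rfl⟩ := exists_sum_eq hrat a
    obtain ⟨t, d, hd, rfl⟩ := hcomp b hb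
    simp only [PoissonAlgebra.pb, map_sum, LinearMap.sum_apply]
    refine sum_mem fun m' _ => sum_mem fun m _ => hmem (toLex (m + ofLex m')) _ ?_ ?_
    · exact pb_mem_weightSpace (m' := ofLex m') hpois (hc m) (hd m').1
    · exact hP.2 _ _ (hle (hd m').2)
  · obtain ⟨t, d, hd, rfl⟩ := hcomp a ha
    rw [map_sum]
    refine sum_mem fun m _ => ?_
    have hm : ρ h (d m) = (character k (ofLex m) h : k) • d m := (hd m).1 h
    rw [hm, Algebra.smul_def]
    exact Ideal.mul_mem_left _ _ (hd m).2

/-- In a rational action every eigenvector is homogeneous. -/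
theorem IsEigenvector.exists_mem_weightSpace (hrat : IsRational ρ) {x : A}
    (hx : IsEigenvector ρ x) : ∃ m, x ∈ weightSpace ρ m := by
  classical
  obtain ⟨s, c, hc, hxs⟩ := exists_sum_eq hrat x
  -- The line through `x` is stable, so it contains the components of `x`; a nonzero component is
  -- then proportional to `x`.
  have hW : ∀ h, ∀ a ∈ Submodule.span k {x}, ρ h a ∈ Submodule.span k {x} := by
    intro h a ha
    obtain ⟨t, rfl⟩ := Submodule.mem_span_singleton.1 ha
    obtain ⟨d, hd⟩ := hx h
    have : ρ h x = d • x := hd.apply_eq_smul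
    rw [map_smul, this]
    exact Submodule.smul_mem _ _ (Submodule.smul_mem _ _ (Submodule.mem_span_singleton_self x))
  have h := mem_of_sum_mem hW s c (fun m _ => hc m)
    (hxs ▸ Submodule.mem_span_singleton_self x)
  have hx0 : x ≠ 0 := (hx 1).choose_spec.2
  obtain ⟨m, hm, hm0⟩ : ∃ m ∈ s, c m ≠ 0 := by
    by_contra! hcon
    exact hx0 (by rw [hxs, Finset.sum_eq_zero hcon])
  obtain ⟨t, ht⟩ := Submodule.mem_span_singleton.1 (h m hm)
  have ht0 : t ≠ 0 := by
    rintro rfl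
    exact hm0 (by rw [← ht, zero_smul])
  exact ⟨m, ((weightSpace ρ m).smul_mem_iff ht0).1 (ht ▸ hc m)⟩

end TorusAction

/-! ### Poisson cores of prime ideals. -/

namespace PoissonAlgebra

section StableIdeals

variable {k A : Type*} [Field k] [CommRing A] [Algebra k A]

theorem derivation_iterate_mul (D : Derivation k A A) (n : ℕ) (a b : A) :
    D^[n] (a * b) = ∑ ij ∈ Finset.HasAntidiagonal.antidiagonal n,
      n.choose ij.1 • (D^[ij.1] a * D^[ij.2] b) := by
  induction n with
  | zero => simp
  | succ n ih =>
    rw [Finset.sum_antidiagonal_choose_succ_nsmul (M := A) fun i j => D^[i] a * D^[j] b]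
    simp only [Function.iterate_succ_apply', ih, map_sum, map_nsmul, Derivation.leibniz,
      smul_add, Finset.sum_add_distrib, smul_eq_mul]
    congr 1
    refine Finset.sum_congr rfl fun ij hij => ?_
    rw [mul_comm, n.choose_symm_of_eq_add (Finset.HasAntidiagonal.mem_antidiagonal.1 hij).symm]

/-- The largest ideal contained in `P` and stable under the derivation `D`. -/
def derivationCore (D : Derivation k A A) (P : Ideal A) : Ideal A where
  carrier := {a | ∀ n : ℕ, D^[n] a ∈ P}
  add_mem' := fun {a b} ha hb n => by
    rw [iterate_map_add]; exact add_mem (ha n) (hb n)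
  zero_mem' := fun n => by rw [iterate_map_zero]; exact zero_mem _
  smul_mem' := fun c a ha n => by
    rw [smul_eq_mul, derivation_iterate_mul]
    exact sum_mem fun ij _ => nsmul_mem (Ideal.mul_mem_left _ _ (ha _)) _

section Core

variable [PoissonAlgebra k A]

theorem core_isPoissonIdeal (J : Ideal A) : IsPoissonIdeal k (core k J) :=
  (isGreatest_core k J).1.1

theorem core_le (J : Ideal A) : core k J ≤ J := (isGreatest_core k J).1.2

theorem le_core {I J : Ideal A} (hI : IsPoissonIdeal k I) (h : I ≤ J) : I ≤ core k J :=
  (isGreatest_core k J).2 ⟨hI, h⟩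

end Core

variable [CharZero k]

/-- Take the least i, j with D^i a and D^j b outside `P`. In the Leibniz expansion of D^(i+j)(ab)
only the (i, j) term can escape `P`, and its binomial coefficient is invertible in characteristic
zero. -/
theorem derivationCore_isPrime (D : Derivation k A A) {P : Ideal A} (hP : P.IsPrime) :
    (derivationCore D P).IsPrime := by
  classical
  refine ⟨fun h => hP.ne_top ((Ideal.eq_top_iff_one _).2 ?_), fun {a b} hab => ?_⟩
  · have h1 : (1 : A) ∈ derivationCore D P := h ▸ Submodule.mem_top
    exact h1 0
  · by_contra! hcon
    have ha : ∃ n, D^[n] a ∉ P := by simpa [derivationCore] using hcon.1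
    have hb : ∃ n, D^[n] b ∉ P := by simpa [derivationCore] using hcon.2
    set i := Nat.find ha with hi
    set j := Nat.find hb with hj
    have h := hab (i + j)
    rw [derivation_iterate_mul, ← Finset.add_sum_erase _ _
      (Finset.HasAntidiagonal.mem_antidiagonal.2 rfl :
        (i, j) ∈ Finset.HasAntidiagonal.antidiagonal (i + j))] at h
    have h' : ∑ x ∈ (Finset.HasAntidiagonal.antidiagonal (i + j)).erase (i, j),
        (i + j).choose x.1 • (D^[x.1] a * D^[x.2] b) ∈ P := by
      refine sum_mem fun x hx => nsmul_mem ?_ _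
      obtain ⟨hne, hx⟩ := Finset.mem_erase.1 hx
      rw [Finset.HasAntidiagonal.mem_antidiagonal] at hx
      rcases lt_trichotomy x.1 i with hlt | heq | hgt
      · exact Ideal.mul_mem_right _ _ (not_not.1 (Nat.find_min ha hlt))
      · exact (hne (Prod.ext heq (by omega))).elim
      · exact Ideal.mul_mem_left _ _ (not_not.1 (Nat.find_min hb (by omega)))
    have h2 := (Ideal.add_mem_iff_left _ h').1 h
    have hc : (((i + j).choose i : ℕ) : k) ≠ 0 :=
      Nat.cast_ne_zero.2 (Nat.choose_pos (by omega)).ne'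
    rw [← Nat.cast_smul_eq_nsmul k] at h2
    have h3 := ((P.restrictScalars k).smul_mem_iff hc).1 h2
    rcases hP.mem_or_mem h3 with h4 | h4
    · exact Nat.find_spec ha h4
    · exact Nat.find_spec hb h4

/-- A minimal prime over an ideal stable under a derivation is stable. -/
theorem derivation_mem_of_mem_minimalPrimes (D : Derivation k A A) {I P : Ideal A}
    (hI : ∀ a ∈ I, D a ∈ I) (hP : P ∈ I.minimalPrimes) {a : A} (ha : a ∈ P) : D a ∈ P := by
  have hIn : ∀ n : ℕ, ∀ b ∈ I, D^[n] b ∈ I := by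
    intro n
    induction n with
    | zero => exact fun b hb => hb
    | succ n ih => exact fun b hb => by rw [Function.iterate_succ_apply']; exact hI _ (ih b hb)
  have hle : derivationCore D P ≤ P := fun b hb => hb 0
  -- By minimality `P` equals its own `derivationCore`; the condition for one iterate of `D` is the
  -- claim.
  have h := hP.2 ⟨derivationCore_isPrime D hP.1.1, fun b hb n => hP.1.2 (hIn n b hb)⟩ hle
  exact h ha 1

variable [PoissonAlgebra k A]

/-- The Poisson core of a prime ideal is prime. -/
theorem core_isPoissonPrime {M : Ideal A} (hM : M.IsPrime) : IsPoissonPrime k (core k M) := by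
  -- A minimal prime over the core inside `M` is stable under all Hamiltonian derivations, so
  -- maximality of the core forces equality.
  obtain ⟨P, hP, hPM⟩ := Ideal.exists_minimalPrimes_le (core_le (k := k) M)
  have hPP : IsPoissonIdeal k P := fun a b hb =>
    derivation_mem_of_mem_minimalPrimes (ham k a)
      (fun c hc => core_isPoissonIdeal (k := k) M a c hc) hP hb
  have : core k M = P := le_antisymm hP.1.2 (le_core hPP hPM)
  rw [this]
  exact ⟨hP.1.1, hPP⟩

end StableIdeals

/-! ### Locally closed points are Poisson primitive. -/

section LocallyClosed

variable {k A : Type*} [Field k] [CommRing A] [Algebra k A] [PoissonAlgebra k A]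

/-- The closure of `P` is the set of Poisson primes above it, so locally closed means isolated there
by a basic open set. -/
theorem isLocallyClosedPoint_iff {P : Ideal A} : IsLocallyClosedPoint k P ↔
    IsPoissonPrime k P ∧ ∃ f ∉ P, ∀ Q, IsPoissonPrime k Q → P ≤ Q → f ∉ Q → Q = P := by
  constructor
  · rintro ⟨P, rfl, U, Z, hU, hZ, hUZ⟩
    refine ⟨⟨P.1.2, P.2⟩, ?_⟩
    have hP : P ∈ U ∩ Z := hUZ ▸ Set.mem_singleton P
    obtain ⟨V, hV, rfl⟩ := isOpen_induced_iff.1 hU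
    obtain ⟨T, hT, rfl⟩ := isClosed_induced_iff.1 hZ
    obtain ⟨_, ⟨f, rfl⟩, hf, hfV⟩ :=
      PrimeSpectrum.isTopologicalBasis_basic_opens.exists_subset_of_mem_open hP.1 hV
    refine ⟨f, hf, fun Q hQ hPQ hfQ => ?_⟩
    have hQT : (⟨Q, hQ.1⟩ : PrimeSpectrum A) ∈ T :=
      ((PrimeSpectrum.le_iff_specializes P.1 ⟨Q, hQ.1⟩).1 hPQ).mem_closed hT hP.2
    have : (⟨⟨Q, hQ.1⟩, hQ.2⟩ : PSpec k A) ∈ ({P} : Set (PSpec k A)) := by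
      rw [hUZ]
      exact ⟨hfV hfQ, hQT⟩
    rw [Set.mem_singleton_iff] at this
    exact congrArg (fun R : PSpec k A => R.1.asIdeal) this
  · rintro ⟨hP, f, hf, h⟩
    refine ⟨⟨⟨P, hP.1⟩, hP.2⟩, rfl, Subtype.val ⁻¹' PrimeSpectrum.basicOpen f,
      Subtype.val ⁻¹' PrimeSpectrum.zeroLocus P,
      (PrimeSpectrum.basicOpen f).isOpen.preimage continuous_subtype_val,
      (PrimeSpectrum.isClosed_zeroLocus _).preimage continuous_subtype_val, ?_⟩
    ext Q
    constructor
    · rintro rfl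
      exact ⟨hf, fun _ h => h⟩
    · rintro ⟨h1, h2⟩
      exact Subtype.ext (PrimeSpectrum.ext (h _ ⟨Q.1.2, Q.2⟩ h2 h1))

/-- In a Jacobson ring some maximal `M` above `P` avoids the isolating element `f`; the core of `M`
is a Poisson prime above `P` avoiding `f`, hence is `P`. -/
theorem IsLocallyClosedPoint.isPoissonPrimitive [CharZero k] [Algebra.FiniteType k A] {P : Ideal A}
    (hP : IsLocallyClosedPoint k P) : IsPoissonPrimitive k P := by
  obtain ⟨⟨hP1, hP2⟩, f, hf, h⟩ := isLocallyClosedPoint_iff.1 hP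
  have : IsJacobsonRing A := isJacobsonRing_of_finiteType (A := k)
  obtain ⟨𝓜, h𝓜, hPM⟩ := isJacobsonRing_iff_sInf_maximal.1 this hP1
  obtain ⟨M, hM, hfM⟩ : ∃ M ∈ 𝓜, f ∉ M := by
    by_contra! hcon
    exact hf (by rw [hPM, Ideal.mem_sInf]; exact fun {I} hI => hcon I hI)
  have hle : P ≤ M := by rw [hPM]; exact sInf_le hM
  rcases h𝓜 M hM with hmax | rfl
  · exact ⟨M, hmax, (h _ (core_isPoissonPrime hmax.isPrime) (le_core hP2 hle)
      fun hf => hfM (core_le M hf)).symm⟩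
  · exact (hfM trivial).elim

end LocallyClosed

end PoissonAlgebra

/-! ### Central fractions: Poisson primitive ideals are rational. -/

open Polynomial in
/-- Clearing denominators in the value of a polynomial at a fraction, simultaneously in two
algebras. -/
theorem exists_pow_mul_aeval_eq {k B L₁ L₂ : Type*} [CommRing k] [CommRing B] [CommRing L₁]
    [CommRing L₂] [Algebra k B] [Algebra k L₁] [Algebra k L₂] (φ₁ : B →ₐ[k] L₁) (φ₂ : B →ₐ[k] L₂)
    {a b : B} {z₁ : L₁} {z₂ : L₂} (h₁ : φ₁ b * z₁ = φ₁ a) (h₂ : φ₂ b * z₂ = φ₂ a) (p : k[X]) :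
    ∃ (N : ℕ) (e : B), φ₁ e = φ₁ b ^ N * aeval z₁ p ∧ φ₂ e = φ₂ b ^ N * aeval z₂ p := by
  induction p using Polynomial.induction_on' with
  | add p q hp hq =>
    obtain ⟨N, e, h3, h4⟩ := hp
    obtain ⟨N', e', h3', h4'⟩ := hq
    refine ⟨N + N', b ^ N' * e + b ^ N * e', ?_, ?_⟩
    · rw [map_add, map_mul, map_mul, map_pow, map_pow, h3, h3', map_add]; ring
    · rw [map_add, map_mul, map_mul, map_pow, map_pow, h4, h4', map_add]; ring
  | monomial n c =>
    refine ⟨n, algebraMap k B c * a ^ n, ?_, ?_⟩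
    · rw [map_mul, map_pow, ← h₁, aeval_monomial, AlgHom.commutes]; ring
    · rw [map_mul, map_pow, ← h₂, aeval_monomial, AlgHom.commutes]; ring

namespace PoissonAlgebra

section Domain

variable {k B : Type*} [Field k] [CommRing B] [IsDomain B] [Algebra k B] [PoissonAlgebra k B]

/-- If every nonzero Poisson ideal meets the complement of `M`, a central element of the quotient
field has a denominator outside `M`. -/
theorem exists_mul_eq_of_central {M : Ideal B}
    (hM : ∀ I : Ideal B, IsPoissonIdeal k I → I ≤ M → I = ⊥)
    {z : FractionRing B} (hz : ∀ w, fractionBi (k := k) z w = 0) :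
    ∃ b ∉ M, ∃ a, algebraMap B (FractionRing B) b * z = algebraMap B (FractionRing B) a := by
  -- The ideal of denominators of `z` is Poisson because `z` is central, and it is nonzero.
  let I : Ideal B :=
    { carrier := {b | ∃ a, algebraMap B (FractionRing B) b * z = algebraMap B (FractionRing B) a}
      add_mem' := by
        rintro b b' ⟨a, ha⟩ ⟨a', ha'⟩
        exact ⟨a + a', by rw [map_add, map_add, add_mul, ha, ha']⟩
      zero_mem' := ⟨0, by simp⟩
      smul_mem' := by
        rintro c b ⟨a, ha⟩
        exact ⟨c * a, by rw [smul_eq_mul, map_mul, map_mul, mul_assoc, ha]⟩ }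
  have hI : IsPoissonIdeal k I := by
    rintro c b ⟨a, ha⟩
    refine ⟨pb k c a, ?_⟩
    rw [← fractionBi_algebraMap, ← fractionBi_algebraMap, ← ha, Derivation.leibniz,
      fractionBi_skew _ z, hz]
    simp [mul_comm]
  by_contra! hcon
  have hbot := hM I hI fun b hb => by
    by_contra hbM
    obtain ⟨a, ha⟩ := hb
    exact hcon b hbM a ha
  obtain ⟨a, s, hs, rfl⟩ := IsFractionRing.div_surjective (A := B) z
  have hs0 : algebraMap B (FractionRing B) s ≠ 0 :=
    IsFractionRing.to_map_ne_zero_of_mem_nonZeroDivisors hs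
  have hsI : s ∈ I := ⟨a, mul_div_cancel₀ _ hs0⟩
  rw [hbot, Ideal.mem_bot] at hsI
  exact hs0 (by rw [hsI, map_zero])

-- Evaluate z = a/b at `M`: by the Nullstellensatz the residue of z is a root of a nonzero p over k.
-- If p(z) ≠ 0, its inverse is also central, so it has a denominator outside `M`; but p(z) vanishes
-- at `M`, a contradiction.
open Polynomial in
theorem isAlgebraic_of_central [Algebra.FiniteType k B] {M : Ideal B} (hmax : M.IsMaximal)
    (hM : ∀ I : Ideal B, IsPoissonIdeal k I → I ≤ M → I = ⊥)
    {z : FractionRing B} (hz : ∀ w, fractionBi (k := k) z w = 0) : IsAlgebraic k z := by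
  let _ : Field (B ⧸ M) := Ideal.Quotient.field M
  have : Module.Finite k (B ⧸ M) := finite_of_finite_type_of_isJacobsonRing k (B ⧸ M)
  obtain ⟨b, hb, a, hba⟩ := exists_mul_eq_of_central hM hz
  have hb0 : Ideal.Quotient.mk M b ≠ 0 := fun h => hb (Ideal.Quotient.eq_zero_iff_mem.1 h)
  obtain ⟨p, hp0, hp⟩ := Algebra.IsAlgebraic.isAlgebraic (R := k)
    (Ideal.Quotient.mk M a / Ideal.Quotient.mk M b)
  obtain ⟨N, e, he1, he2⟩ := exists_pow_mul_aeval_eq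
    (IsScalarTower.toAlgHom k B (FractionRing B)) (Ideal.Quotient.mkₐ k M) hba
    (z₂ := Ideal.Quotient.mk M a / Ideal.Quotient.mk M b) (mul_div_cancel₀ _ hb0) p
  rw [hp, mul_zero] at he2
  have heM : e ∈ M := Ideal.Quotient.eq_zero_iff_mem.1 he2
  refine ⟨p, hp0, ?_⟩
  by_contra hw
  have hwc : ∀ v, fractionBi (k := k) (aeval z p)⁻¹ v = 0 := by
    intro v
    rw [Derivation.leibniz_inv, Derivation.map_aeval]
    have : fractionBi (k := k) z = 0 := Derivation.ext hz
    rw [this, smul_zero, smul_zero, Derivation.zero_apply]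
  obtain ⟨c, hc, d, hcd⟩ := exists_mul_eq_of_central hM hwc
  have h : b ^ N * c = d * e := by
    apply IsFractionRing.injective B (FractionRing B)
    have he1' : algebraMap B (FractionRing B) e =
      algebraMap B (FractionRing B) b ^ N * aeval z p := he1
    rw [map_mul, map_mul, map_pow, he1', ← hcd]
    field_simp
  have h' : b ^ N * c ∈ M := h ▸ Ideal.mul_mem_left _ _ heM
  rcases hmax.isPrime.mem_or_mem h' with h1 | h1
  · exact hb (hmax.isPrime.mem_of_pow_mem _ h1)
  · exact hc h1

end Domain

section Quotient

variable {k A : Type*} [Field k] [CommRing A] [Algebra k A] [PoissonAlgebra k A]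

theorem mem_fractCenter {P : Ideal A} [P.IsPrime] (hP : IsPoissonIdeal k P)
    {z : FractionRing (A ⧸ P)} :
    z ∈ fractCenter k P hP ↔ ∀ w, letI := quotient hP; fractionBi (k := k) z w = 0 := Iff.rfl

theorem IsPoissonPrimitive.isPoissonRational [CharZero k] [Algebra.FiniteType k A] {P : Ideal A}
    (hP : IsPoissonPrimitive k P) : IsPoissonRational k P := by
  obtain ⟨M, hM, rfl⟩ := hP
  obtain ⟨h1, h2⟩ := core_isPoissonPrime (k := k) hM.isPrime
  refine ⟨h1, h2, fun z hz => ?_⟩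
  let _ := quotient h2
  have hker : RingHom.ker (Ideal.Quotient.mk (core k M)) ≤ M := by
    rw [Ideal.mk_ker]; exact core_le M
  refine isAlgebraic_of_central (k := k) (M := M.map (Ideal.Quotient.mk (core k M)))
    (hM.map_of_surjective_of_ker_le Ideal.Quotient.mk_surjective hker)
    (fun I hI hIM => ?_) hz
  have hle : I.comap (Ideal.Quotient.mk (core k M)) ≤ core k M := by
    refine le_core (fun a b hb => ?_) ?_
    · exact hI (Ideal.Quotient.mk _ a) _ hb
    · refine (Ideal.comap_mono hIM).trans ?_
      rw [Ideal.comap_map_of_surjective' _ Ideal.Quotient.mk_surjective]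
      exact sup_le le_rfl hker
  rw [eq_bot_iff]
  intro y hy
  obtain ⟨a, rfl⟩ := Ideal.Quotient.mk_surjective y
  exact Ideal.Quotient.eq_zero_iff_mem.2 (hle hy)

/-- The hypothesis is the vanishing of u² {b, f/u} modulo `P`, by the quotient rule. -/
theorem central_of_forall_mem {P : Ideal A} [P.IsPrime] (hP : IsPoissonIdeal k P) {f u : A}
    (hu : u ∉ P) (h : ∀ b, u * pb k b f - f * pb k b u ∈ P) :
    algebraMap (A ⧸ P) (FractionRing (A ⧸ P)) (Ideal.Quotient.mk P f) /
      algebraMap (A ⧸ P) (FractionRing (A ⧸ P)) (Ideal.Quotient.mk P u) ∈ fractCenter k P hP := by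
  rw [mem_fractCenter]
  intro w
  let _ := quotient hP
  set U := algebraMap (A ⧸ P) (FractionRing (A ⧸ P)) (Ideal.Quotient.mk P u) with hU
  set F := algebraMap (A ⧸ P) (FractionRing (A ⧸ P)) (Ideal.Quotient.mk P f) with hF
  have hU0 : U ≠ 0 := fun h0 => hu (Ideal.Quotient.eq_zero_iff_mem.1
    ((map_eq_zero_iff _ (IsFractionRing.injective (A ⧸ P) (FractionRing (A ⧸ P)))).1 h0))
  refine Derivation.congr_fun (D2 := 0) (fraction_derivation_ext fun b => ?_) w
  obtain ⟨b, rfl⟩ := Ideal.Quotient.mk_surjective b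
  have hb : U * fractionBi (k := k) (algebraMap _ _ (Ideal.Quotient.mk P b)) F -
      F * fractionBi (k := k) (algebraMap _ _ (Ideal.Quotient.mk P b)) U = 0 := by
    rw [hU, hF, fractionBi_algebraMap, fractionBi_algebraMap, quotient_pb_mk, quotient_pb_mk]
    simp only [← map_mul, ← map_sub]
    rw [Ideal.Quotient.eq_zero_iff_mem.2 (h b), map_zero]
  rw [fractionBi_skew, Derivation.leibniz_div]
  simp only [smul_eq_mul, hb, mul_zero, neg_zero, Derivation.zero_apply]

end Quotient

end PoissonAlgebra

/-! ### Rational primes are locally closed when there are finitely many stable Poisson primes. -/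

namespace TorusAction

open PoissonAlgebra

variable {k A : Type*} [Field k] [CommRing A] [Algebra k A] [PoissonAlgebra k A] {r : ℕ}
  {ρ : (Fin r → kˣ) →* (A ≃ₐ[k] A)}

/-- A Poisson rational prime contains every larger Poisson prime having the same homogeneous
elements; here elements of the larger prime are given as sums of homogeneous elements. -/
theorem sum_mem_of_isPoissonRational (hrat : IsRational ρ) (hpois : IsPoisson ρ) {P P' : Ideal A}
    (hP : IsPoissonRational k P) (hP' : IsPoissonPrime k P') (hle : P ≤ P')
    (hhom : ∀ m, ∀ a ∈ weightSpace ρ m, a ∈ P' → a ∈ P) (s : Finset (Fin r → ℤ)) :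
    ∀ c : (Fin r → ℤ) → A, (∀ i ∈ s, ∃ m, c i ∈ weightSpace ρ m) → ∑ i ∈ s, c i ∈ P' →
      ∑ i ∈ s, c i ∈ P := by
  classical
  obtain ⟨hP1, hP2, halg⟩ := hP
  have hPr' := hP'.1
  induction s using Finset.strongInduction with
  | H s ih =>
    intro c hc hs
    by_contra hfP
    obtain ⟨i, hi⟩ : s.Nonempty := by
      by_contra hcon
      rw [Finset.not_nonempty_iff_eq_empty] at hcon
      simp [hcon] at hfP
    have hss := Finset.erase_ssubset hi
    obtain ⟨m, hm⟩ := hc i hi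
    have hsum := Finset.add_sum_erase s c hi
    have hu : c i ∉ P' := by
      intro hu
      have h1 := ih _ hss c (fun j hj => hc j (Finset.mem_of_mem_erase hj))
        ((Ideal.add_mem_iff_right _ hu).1 (hsum ▸ hs))
      exact hfP (hsum ▸ add_mem (hhom m _ hm hu) h1)
    have huP : c i ∉ P := fun h => hu (hle h)
    -- Write u = `c i` and f for the sum. For homogeneous b the term of f at `i` cancels in u {b, f}
    -- - f {b, u}, leaving a shorter sum of homogeneous elements of `P'`. Here `s` merely labels
    -- terms, since their weights have shifted.
    have hcen : ∀ b, c i * pb k b (∑ j ∈ s, c j) - (∑ j ∈ s, c j) * pb k b (c i) ∈ P := by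
      intro b
      obtain ⟨t, d, hd, rfl⟩ := exists_sum_eq hrat b
      have e : c i * pb k (∑ l ∈ t, d l) (∑ j ∈ s, c j) -
          (∑ j ∈ s, c j) * pb k (∑ l ∈ t, d l) (c i) =
          ∑ l ∈ t, (c i * pb k (d l) (∑ j ∈ s, c j) - (∑ j ∈ s, c j) * pb k (d l) (c i)) := by
        simp only [pb, map_sum, LinearMap.sum_apply, Finset.mul_sum, Finset.sum_sub_distrib]
        rw [Finset.sum_comm]
      rw [e]
      refine sum_mem fun l _ => ?_
      have e' : c i * pb k (d l) (∑ j ∈ s, c j) - (∑ j ∈ s, c j) * pb k (d l) (c i) =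
          ∑ j ∈ s.erase i, (c i * pb k (d l) (c j) - c j * pb k (d l) (c i)) := by
        rw [Finset.sum_sub_distrib, ← Finset.sum_mul, ← Finset.mul_sum, ← hsum, pb_add_right]
        simp only [pb, map_sum]
        ring
      rw [e']
      refine ih _ hss _ (fun j hj => ?_) ?_
      · obtain ⟨m', hm'⟩ := hc j (Finset.mem_of_mem_erase hj)
        refine ⟨m + (l + m'), sub_mem
          (weightSpace_mul_mem ρ hm (pb_mem_weightSpace hpois (hd l) hm')) ?_⟩
        have h1 := weightSpace_mul_mem ρ hm' (pb_mem_weightSpace hpois (hd l) hm)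
        rwa [show m' + (l + m) = m + (l + m') by abel] at h1
      · rw [← e']
        exact sub_mem (Ideal.mul_mem_left _ _ (hP'.2 _ _ hs)) (Ideal.mul_mem_right _ _ hs)
    have hz := halg _ (central_of_forall_mem hP2 huP hcen)
    set z := algebraMap (A ⧸ P) (FractionRing (A ⧸ P)) (Ideal.Quotient.mk P (∑ j ∈ s, c j)) /
      algebraMap (A ⧸ P) (FractionRing (A ⧸ P)) (Ideal.Quotient.mk P (c i)) with hzdef
    have hne : ∀ a ∉ P, algebraMap (A ⧸ P) (FractionRing (A ⧸ P)) (Ideal.Quotient.mk P a) ≠ 0 :=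
      fun a ha h0 => ha (Ideal.Quotient.eq_zero_iff_mem.1
        ((map_eq_zero_iff _ (IsFractionRing.injective (A ⧸ P) (FractionRing (A ⧸ P)))).1 h0))
    have hz0 : z ≠ 0 := div_ne_zero (hne _ hfP) (hne _ huP)
    -- Clear denominators in the minimal polynomial of z = f/u. Modulo `P'` the fraction becomes 0
    -- with u still nonzero, so the constant coefficient would vanish, although z ≠ 0.
    obtain ⟨N, e, he1, he2⟩ := exists_pow_mul_aeval_eq
      ((IsScalarTower.toAlgHom k (A ⧸ P) (FractionRing (A ⧸ P))).comp (Ideal.Quotient.mkₐ k P))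
      (Ideal.Quotient.mkₐ k P') (a := ∑ j ∈ s, c j) (b := c i) (z₁ := z) (z₂ := 0)
      (mul_div_cancel₀ _ (hne _ huP))
      (by rw [mul_zero]; exact (Ideal.Quotient.eq_zero_iff_mem.2 hs).symm) (minpoly k z)
    rw [minpoly.aeval, mul_zero] at he1
    have heP : e ∈ P := by
      by_contra heP
      exact hne _ heP he1
    have h2 : Ideal.Quotient.mkₐ k P' e = 0 := Ideal.Quotient.eq_zero_iff_mem.2 (hle heP)
    rw [h2, Polynomial.aeval_def, Polynomial.eval₂_at_zero, eq_comm] at he2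
    have hc0 := minpoly.coeff_zero_ne_zero hz.isIntegral hz0
    rcases mul_eq_zero.1 he2 with h3 | h3
    · exact hu (Ideal.Quotient.eq_zero_iff_mem.1 (eq_zero_of_pow_eq_zero h3))
    · exact hc0 ((map_eq_zero _).1 h3)

/-- The isolating element is a product of elements outside `P`, one from each stable Poisson prime
not contained in `P`. -/
theorem isLocallyClosedPoint_of_isPoissonRational [CharZero k] (hrat : IsRational ρ)
    (hpois : IsPoisson ρ)
    (hfin : {P : Ideal A | IsPoissonPrime k P ∧ IsStable ρ P}.Finite) {P : Ideal A}
    (hP : IsPoissonRational k P) : IsLocallyClosedPoint k P := by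
  classical
  have hP1 : P.IsPrime := hP.1
  refine isLocallyClosedPoint_iff.2 ⟨⟨hP.1, hP.2.1⟩, ?_⟩
  have hex : ∀ J : Ideal A, ∃ f, ¬ J ≤ P → f ∈ J ∧ f ∉ P := by
    intro J
    by_cases hJ : J ≤ P
    · exact ⟨0, fun h => (h hJ).elim⟩
    · obtain ⟨f, hf⟩ := Set.not_subset.1 hJ
      exact ⟨f, fun _ => hf⟩
  choose f hf using hex
  refine ⟨∏ J ∈ hfin.toFinset with ¬ J ≤ P, f J, ?_, fun Q hQ hPQ hfQ => ?_⟩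
  · rw [hP1.prod_mem_iff]
    rintro ⟨J, hJ, hJP⟩
    exact (hf J (Finset.mem_filter.1 hJ).2).2 hJP
  · obtain ⟨J, hJ, hJs, hJQ, hJhom⟩ := exists_stable_poissonPrime hrat hpois hQ
    by_cases hJP : J ≤ P
    · refine le_antisymm (fun a ha => ?_) hPQ
      obtain ⟨s, c, hc, rfl⟩ := exists_sum_eq hrat a
      exact sum_mem_of_isPoissonRational hrat hpois hP hQ hPQ
        (fun m a ha haQ => hJP (hJhom m a ha haQ)) s c (fun i _ => ⟨i, hc i⟩) ha
    · refine (hfQ ?_).elim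
      refine Ideal.mem_of_dvd _ (Finset.dvd_prod_of_mem f (Finset.mem_filter.2
        ⟨hfin.mem_toFinset.2 ⟨hJ, hJs⟩, hJP⟩)) (hJQ (hf J hJP).1)

/-- The Poisson Dixmier-Moeglin equivalence for an affine Poisson algebra with a rational torus
action having finitely many stable Poisson primes. -/
theorem dixmierMoeglin_of_finite [CharZero k] [Algebra.FiniteType k A] (hrat : IsRational ρ)
    (hpois : IsPoisson ρ)
    (hfin : {P : Ideal A | IsPoissonPrime k P ∧ IsStable ρ P}.Finite) : DixmierMoeglin k A := by
  have h3 : ∀ P : Ideal A, IsPoissonRational k P → IsLocallyClosedPoint k P :=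
    fun P hP => isLocallyClosedPoint_of_isPoissonRational hrat hpois hfin hP
  exact ⟨Set.Subset.antisymm (fun P hP => h3 P (IsPoissonPrimitive.isPoissonRational hP))
      fun P hP => IsLocallyClosedPoint.isPoissonPrimitive hP,
    Set.Subset.antisymm (fun P hP => (IsLocallyClosedPoint.isPoissonPrimitive hP).isPoissonRational)
      h3⟩

end TorusAction

/-! ### Algebraic Poisson-Ore variables over a subfield. -/

section FieldDerivation

variable {k L : Type*} [Field k] [Field L] [Algebra k L] {K : Subfield L}

theorem Subfield.derivation_mem_closure {s : Set L} (E : Derivation k L L)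
    (h : ∀ a ∈ s, E a ∈ Subfield.closure s) {a : L} (ha : a ∈ Subfield.closure s) :
    E a ∈ Subfield.closure s := by
  induction ha using Subfield.closure_induction with
  | mem x hx => exact h x hx
  | one => rw [E.map_one_eq_zero]; exact zero_mem _
  | add x y hx hy ihx ihy => rw [map_add]; exact add_mem ihx ihy
  | neg x hx ih => rw [map_neg]; exact neg_mem ih
  | inv x hx ih =>
    rw [E.leibniz_inv, smul_eq_mul]
    exact mul_mem (neg_mem (pow_mem (inv_mem hx) 2)) ih
  | mul x y hx hy ihx ihy =>
    rw [E.leibniz, smul_eq_mul, smul_eq_mul]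
    exact add_mem (mul_mem hx ihy) (mul_mem hy ihx)

open Polynomial

theorem Subfield.exists_derivation_aeval (E : Derivation k L L) (hE : ∀ a ∈ K, E a ∈ K) (x : L)
    (p : K[X]) : ∃ q : K[X], (∀ i, (q.coeff i : L) = E (p.coeff i)) ∧
      E (aeval x p) = aeval x q + aeval x (derivative p) * E x := by
  induction p using Polynomial.induction_on' with
  | add p p' hp hp' =>
    obtain ⟨q, h1, h2⟩ := hp
    obtain ⟨q', h1', h2'⟩ := hp'
    refine ⟨q + q', fun i => by simp [h1, h1'], ?_⟩
    simp only [map_add, h2, h2']; ring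
  | monomial n a =>
    refine ⟨monomial n ⟨E a, hE a a.2⟩, fun i => ?_, ?_⟩
    · simp only [coeff_monomial]
      split_ifs <;> simp
    · simp only [aeval_monomial, derivative_monomial, Derivation.leibniz, Derivation.leibniz_pow,
        smul_eq_mul, nsmul_eq_mul, map_mul, map_natCast]
      change (a : L) * (n * (x ^ (n - 1) * E x)) + x ^ n * E a =
        E a * x ^ n + (a : L) * n * x ^ (n - 1) * E x
      ring

/-- If a derivation of `L` stabilises a subfield `K` and maps an element `x` algebraic over `K`
to `α x + β` with `α, β ∈ K`, then it acts on the coefficients of the minimal polynomial of `x`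
in the same way as on the coefficients of a power of `x`. -/
theorem Subfield.derivation_minpoly_coeff (E : Derivation k L L) (hE : ∀ a ∈ K, E a ∈ K) {x : L}
    (hx : IsIntegral K x) {α β : L} (hα : α ∈ K) (hβ : β ∈ K) (hEx : E x = α * x + β) (i : ℕ) :
    E ((minpoly K x).coeff i) + i * α * (minpoly K x).coeff i +
      (i + 1) * β * (minpoly K x).coeff (i + 1) =
        (minpoly K x).natDegree * α * (minpoly K x).coeff i := by
  set f := minpoly K x with hf
  set d := f.natDegree with hd
  obtain ⟨q, hq1, hq2⟩ := Subfield.exists_derivation_aeval E hE x f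
  -- `g` expresses E(f(x)) - d α f(x) as a polynomial in x. It kills x, and subtracting d α f
  -- removes its term of degree d, so it is zero by minimality.
  let g : K[X] := q + derivative f * (C ⟨α, hα⟩ * X + C ⟨β, hβ⟩) - C ((d : K) * ⟨α, hα⟩) * f
  have hg0 : aeval x g = 0 := by
    have hfx : aeval x f = 0 := minpoly.aeval K x
    rw [hfx, map_zero, hEx] at hq2
    simp only [g, map_sub, map_add, map_mul, aeval_X, aeval_C, hfx, mul_zero, sub_zero]
    exact hq2.symm
  have hcoeff : ∀ i, (g.coeff i : L) = E (f.coeff i) + i * α * f.coeff i +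
      (i + 1) * β * f.coeff (i + 1) - d * α * f.coeff i := by
    intro i
    have e : derivative f * (C ⟨α, hα⟩ * X + C ⟨β, hβ⟩) =
        C ⟨α, hα⟩ * (derivative f * X) + C ⟨β, hβ⟩ * derivative f := by ring
    simp only [g, e, coeff_sub, coeff_add, coeff_C_mul]
    rcases i with - | i
    · simp [coeff_derivative, hq1]
    · simp [coeff_derivative, hq1]
      ring
  have hmonic : f.Monic := minpoly.monic hx
  have hg : g = 0 := by
    by_contra hne
    have h1 := minpoly.degree_le_of_ne_zero K x hne hg0
    refine absurd h1 (not_le.2 (((degree_lt_iff_coeff_zero g d).2 fun m hm => ?_)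
      |>.trans_eq (degree_eq_natDegree hmonic.ne_zero).symm))
    rw [← ZeroMemClass.coe_eq_zero, hcoeff]
    have h2 : f.coeff (m + 1) = 0 := coeff_eq_zero_of_natDegree_lt (by omega)
    rcases hm.eq_or_lt with rfl | hlt
    · rw [h2]
      have h3 : f.coeff d = 1 := hmonic
      rw [h3]
      simp
    · rw [h2, coeff_eq_zero_of_natDegree_lt hlt]
      simp
  have := hcoeff i
  rw [hg] at this
  simp only [coeff_zero, ZeroMemClass.coe_zero] at this
  linear_combination -this

open PoissonAlgebra

/-- An element which behaves like an Ore variable over a subfield is transcendental over the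
subfield or belongs to it. -/
theorem Subfield.mem_of_isIntegral_of_pb [CharZero k] [PoissonAlgebra k L] (D : Derivation k L L)
    (hD : ∀ a ∈ K, D a ∈ K) (hK : ∀ a ∈ K, ∀ b ∈ K, pb k a b ∈ K) {x : L} {c : k} (hc : c ≠ 0)
    (hDx : D x = c • x) (hpb : ∀ r ∈ K, pb k x r - D r * x ∈ K)
    (hcK : algebraMap k L c ∈ K) (hx : IsIntegral K x) : x ∈ K := by
  have hL : CharZero L := charZero_of_injective_algebraMap (algebraMap k L).injective
  set γ := algebraMap k L c with hγ
  have hγ0 : γ ≠ 0 := (_root_.map_ne_zero _).2 hc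
  rw [Algebra.smul_def] at hDx
  have hE : ∀ r y : L, (-ham k r) y = pb k y r := fun r y => by
    rw [Derivation.neg_apply, ham_apply, pb_skew, neg_neg]
  have hEK : ∀ r ∈ K, ∀ a ∈ K, (-ham k r) a ∈ K := fun r hr a ha => by
    rw [hE]; exact hK a ha r hr
  -- the coefficient of second highest degree of the minimal polynomial
  set d := (minpoly K x).natDegree with hd
  have hdpos : 0 < d := minpoly.natDegree_pos hx
  have hd0 : (d : L) ≠ 0 := Nat.cast_ne_zero.2 hdpos.ne'
  obtain ⟨e, he⟩ : ∃ e, d = e + 1 := ⟨d - 1, by omega⟩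
  have hlead : (minpoly K x).coeff (e + 1) = 1 := by rw [← he]; exact minpoly.monic hx
  obtain ⟨a, ha⟩ : ∃ a : L, a = ((minpoly K x).coeff e : K) := ⟨_, rfl⟩
  have haK : a ∈ K := ha ▸ ((minpoly K x).coeff e).2
  have hdL : (d : L) = e + 1 := by rw [he]; push_cast; rfl
  have hDa : D a = γ * a := by
    have h := Subfield.derivation_minpoly_coeff D hD hx hcK (zero_mem K)
      (by rw [hDx, add_zero]) e
    rw [← ha, ← hd, hdL] at h
    linear_combination h
  have hra : ∀ r ∈ K, pb k a r = D r * a - d * (pb k x r - D r * x) := by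
    intro r hr
    have h := Subfield.derivation_minpoly_coeff (-ham k r) (hEK r hr) hx (hD r hr) (hpb r hr)
      (by rw [hE]; ring) e
    rw [← ha, ← hd, hE, hlead, hdL] at h
    rw [hdL]
    push_cast at h
    linear_combination h
  -- the translate of `x` with zero such coefficient
  have hdD : D (d : L) = 0 := D.map_natCast d
  -- This translate removes the inhomogeneous term: {z, r} = D(r) z. It remains to show z = 0.
  set z := d * x + a with hz
  have hDz : D z = γ * z := by
    rw [hz, map_add, D.leibniz, hdD, hDx, hDa, smul_zero, add_zero, smul_eq_mul]; ring
  have hrz : ∀ r ∈ K, pb k z r = D r * z := by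
    intro r hr
    rw [hz, pb_add_left, pb_mul_left, hra r hr, pb_skew k (d : L), ← ham_apply,
      (ham k r).map_natCast]
    ring
  have hzint : IsIntegral K z := by
    refine IsIntegral.add ?_ (isIntegral_algebraMap (x := (⟨a, haK⟩ : K)))
    exact IsIntegral.mul (isIntegral_algebraMap (x := (d : K))) hx
  set m := (minpoly K z).natDegree with hm
  have hm0 : (m : L) ≠ 0 := Nat.cast_ne_zero.2 (minpoly.natDegree_pos hzint).ne'
  obtain ⟨b, hb⟩ : ∃ b : L, b = ((minpoly K z).coeff 0 : K) := ⟨_, rfl⟩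
  have hbK : b ∈ K := hb ▸ ((minpoly K z).coeff 0).2
  have hDb : D b = m * γ * b := by
    have h := Subfield.derivation_minpoly_coeff D hD hzint hcK (zero_mem K)
      (by rw [hDz, add_zero]) 0
    rw [← hb, ← hm] at h
    push_cast at h
    linear_combination h
  -- The constant coefficient b satisfies {b, r} = m D(r) b for r in `K`; take r = b. With D(b) = m
  -- γ b this reads m² γ b² = 0.
  have hbb : 0 = m * D b * b := by
    have h := Subfield.derivation_minpoly_coeff (-ham k b) (hEK b hbK) hzint (hD b hbK)
      (zero_mem K) (by rw [hE, hrz b hbK, add_zero]) 0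
    rw [← hb, ← hm, hE, pb_self] at h
    push_cast at h
    linear_combination h
  have hb0 : b = 0 := by
    rw [hDb] at hbb
    by_contra hne
    exact mul_ne_zero (mul_ne_zero hm0 (mul_ne_zero (mul_ne_zero hm0 hγ0) hne)) hne hbb.symm
  have hz0 : z = 0 := by
    by_contra hne
    exact minpoly.coeff_zero_ne_zero hzint hne (Subtype.ext (hb.symm.trans hb0))
  have hxa : x = -a / d := by
    field_simp
    linear_combination hz0
  rw [hxa]
  exact div_mem (neg_mem haK) (natCast_mem K d)

end FieldDerivation

/-! ### One Poisson-Ore variable modulo a stable Poisson prime. -/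

namespace PoissonAlgebra

variable {k A : Type*} [Field k] [CommRing A] [Algebra k A]

/-- Since x is the fraction t/s modulo both primes, s^N p(x) is congruent to the same element of `R`
modulo both. -/
theorem aeval_mem_of_mul_sub_mem {R : Subalgebra k A} {x : A} {P P' : Ideal A} (hP' : P'.IsPrime)
    (hPP' : ∀ r ∈ R, r ∈ P → r ∈ P') {s t : A} (hs : s ∈ R) (ht : t ∈ R) (hsP' : s ∉ P')
    (hst : s * x - t ∈ P) (hst' : s * x - t ∈ P') (p : Polynomial R)
    (hp : Polynomial.aeval x p ∈ P) : Polynomial.aeval x p ∈ P' := by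
  have hmk : ∀ Q : Ideal A, Polynomial.aeval (Ideal.Quotient.mk Q x) p =
      Ideal.Quotient.mk Q (Polynomial.aeval x p) := fun Q =>
    Polynomial.aeval_algHom_apply (Ideal.Quotient.mkₐ R Q) x p
  have hbz : ∀ Q : Ideal A, s * x - t ∈ Q →
      Algebra.ofId R (A ⧸ Q) ⟨s, hs⟩ * Ideal.Quotient.mk Q x = Algebra.ofId R (A ⧸ Q) ⟨t, ht⟩ := by
    intro Q hQ
    change Ideal.Quotient.mk Q s * Ideal.Quotient.mk Q x = Ideal.Quotient.mk Q t
    rw [← map_mul]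
    exact Ideal.Quotient.eq.2 hQ
  obtain ⟨N, e, h1, h2⟩ := exists_pow_mul_aeval_eq (Algebra.ofId R (A ⧸ P))
    (Algebra.ofId R (A ⧸ P')) (hbz P hst) (hbz P' hst') p
  rw [hmk, Ideal.Quotient.eq_zero_iff_mem.2 hp, mul_zero] at h1
  have he : (e : A) ∈ P' := hPP' _ e.2 (Ideal.Quotient.eq_zero_iff_mem.1 h1)
  have h3 : s ^ N * Polynomial.aeval x p ∈ P' := by
    rw [← Ideal.Quotient.eq_zero_iff_mem, map_mul, map_pow, ← hmk]
    exact h2.symm.trans (Ideal.Quotient.eq_zero_iff_mem.2 he)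
  exact (hP'.mem_or_mem h3).resolve_left fun h => hsP' (hP'.mem_of_pow_mem _ h)

/-- A derivation of `A` stabilising a prime ideal `P`, extended to the quotient field of `A/P`. -/
theorem exists_derivation_fractionRing (D : Derivation k A A) {P : Ideal A} [P.IsPrime]
    (hP : ∀ a ∈ P, D a ∈ P) :
    ∃ E : Derivation k (FractionRing (A ⧸ P)) (FractionRing (A ⧸ P)),
      ∀ a, E (algebraMap _ _ (Ideal.Quotient.mk P a)) =
        algebraMap _ _ (Ideal.Quotient.mk P (D a)) := by
  let f : A ⧸ P → A ⧸ P := Quotient.map D fun a b hab => by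
    have h := (Submodule.quotientRel_def P).1 hab
    refine (Submodule.quotientRel_def P).2 ?_
    rw [← map_sub]
    exact hP _ h
  have hf : ∀ a, f (Ideal.Quotient.mk P a) = Ideal.Quotient.mk P (D a) := fun _ => rfl
  let F : Derivation k (A ⧸ P) (A ⧸ P) := Derivation.mk'
    { toFun := f
      map_add' := fun x y => by
        obtain ⟨a, rfl⟩ := Ideal.Quotient.mk_surjective x
        obtain ⟨b, rfl⟩ := Ideal.Quotient.mk_surjective y
        rw [← map_add, hf, hf, hf, map_add, map_add]
      map_smul' := fun r x => by
        obtain ⟨a, rfl⟩ := Ideal.Quotient.mk_surjective x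
        rw [smul_mk, hf, hf, D.map_smul]
        rfl } fun x y => by
    obtain ⟨a, rfl⟩ := Ideal.Quotient.mk_surjective x
    obtain ⟨b, rfl⟩ := Ideal.Quotient.mk_surjective y
    change f (Ideal.Quotient.mk P a * Ideal.Quotient.mk P b) =
      Ideal.Quotient.mk P a * f (Ideal.Quotient.mk P b) +
        Ideal.Quotient.mk P b * f (Ideal.Quotient.mk P a)
    rw [← map_mul, hf, hf, hf, D.leibniz]
    simp only [smul_eq_mul, map_add, map_mul]
  refine ⟨liftDerivation ((Algebra.linearMap (A ⧸ P) (FractionRing (A ⧸ P))).compDer F),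
    fun a => ?_⟩
  rw [liftDerivation_algebraMap]
  rfl

variable [PoissonAlgebra k A]

/-- Modulo a Poisson prime stable under the derivation `D`, an Ore variable over a subalgebra `R`
is either a fraction of elements of `R` or transcendental over `R`. -/
theorem exists_mul_sub_mem_or_transcendental [CharZero k] (D : Derivation k A A)
    {R : Subalgebra k A} (hRD : ∀ r ∈ R, D r ∈ R) (hR : ∀ r ∈ R, ∀ s ∈ R, pb k r s ∈ R)
    {x : A} {c : k} (hc : c ≠ 0) (hDx : D x = c • x) (hx : ∀ r ∈ R, pb k x r - D r * x ∈ R)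
    {P : Ideal A} (hP : IsPoissonPrime k P) (hDP : ∀ a ∈ P, D a ∈ P) :
    (∃ s ∈ R, s ∉ P ∧ ∃ t ∈ R, s * x - t ∈ P) ∨
      ∀ p : Polynomial R, Polynomial.aeval x p ∈ P → ∀ i, (p.coeff i : A) ∈ P := by
  have hP1 := hP.1
  obtain ⟨E, hE⟩ := exists_derivation_fractionRing D hDP
  let _ := quotient hP.2
  let _ := fractionRing k (A ⧸ P)
  set L := FractionRing (A ⧸ P)
  let φ : A →ₐ[k] L := (IsScalarTower.toAlgHom k (A ⧸ P) L).comp (Ideal.Quotient.mkₐ k P)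
  have hφ0 : ∀ a, φ a = 0 ↔ a ∈ P := fun a =>
    (map_eq_zero_iff _ (IsFractionRing.injective (A ⧸ P) L)).trans Ideal.Quotient.eq_zero_iff_mem
  have hφE : ∀ a, E (φ a) = φ (D a) := hE
  have hφpb : ∀ a b, pb k (φ a) (φ b) = φ (pb k a b) := fun a b =>
    fractionRing_pb_algebraMap (Ideal.Quotient.mk P a) (Ideal.Quotient.mk P b)
  let S : Subring L := (R.map φ).toSubring
  have hS : ∀ r ∈ R, φ r ∈ (S : Set L) := fun r hr => ⟨r, hr, rfl⟩
  set K := Subfield.closure (S : Set L) with hKdef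
  have hSK : ∀ r ∈ R, φ r ∈ K := fun r hr => Subfield.subset_closure (hS r hr)
  have hDK : ∀ a ∈ K, E a ∈ K := fun a ha => Subfield.derivation_mem_closure E
    (by rintro _ ⟨r, hr, rfl⟩; exact hφE r ▸ hSK _ (hRD r hr)) ha
  have hK1 : ∀ r ∈ R, ∀ b ∈ K, pb k (φ r) b ∈ K := fun r hr b hb =>
    Subfield.derivation_mem_closure (ham k (φ r))
      (by
        rintro _ ⟨s, hs, rfl⟩
        change pb k (φ r) (φ s) ∈ K
        rw [hφpb]
        exact hSK _ (hR r hr s hs)) hb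
  have hK : ∀ a ∈ K, ∀ b ∈ K, pb k a b ∈ K := fun a ha b hb =>
    Subfield.derivation_mem_closure (ham k a)
      (by
        rintro _ ⟨s, hs, rfl⟩
        change pb k a (φ s) ∈ K
        rw [pb_skew]
        exact neg_mem (hK1 s hs a ha)) hb
  have hxK : ∀ r ∈ K, pb k (φ x) r - E r * φ x ∈ K := by
    intro r hr
    exact Subfield.derivation_mem_closure (ham k (φ x) - (φ x) • E)
      (by
        rintro _ ⟨s, hs, rfl⟩
        have h := hSK _ (hx s hs)
        rw [map_sub, map_mul, ← hφE, ← hφpb, mul_comm] at h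
        exact h) hr |> fun h => by
          rwa [Derivation.sub_apply, Derivation.smul_apply, smul_eq_mul, mul_comm] at h
  by_cases hint : IsIntegral K (φ x)
  · left
    have hmem := Subfield.mem_of_isIntegral_of_pb E hDK hK hc
      (by rw [hφE, hDx, map_smul]) hxK
      (by rw [← φ.commutes]; exact hSK _ (R.algebraMap_mem c)) hint
    obtain ⟨y, hy, z, hz, hyz⟩ := Subfield.mem_closure_iff.1 hmem
    rw [Subring.closure_eq] at hy hz
    obtain ⟨t, ht, rfl⟩ := hy
    obtain ⟨s, hs, rfl⟩ := hz
    -- The fraction may have zero denominator, with value 0 by convention; then `x` lies in `P` and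
    -- 0/1 represents it.
    by_cases hsP : s ∈ P
    · have h0 : φ s = 0 := (hφ0 s).2 hsP
      have hx0 : φ x = 0 := by
        rw [← hyz]
        exact (congrArg (_ / ·) h0).trans (div_zero _)
      exact ⟨1, R.one_mem, fun h => hP1.ne_top ((Ideal.eq_top_iff_one P).2 h), 0, R.zero_mem,
        by rw [one_mul, sub_zero]; exact (hφ0 x).1 hx0⟩
    · refine ⟨s, hs, hsP, t, ht, (hφ0 _).1 ?_⟩
      rw [map_sub, map_mul, ← hyz]
      exact sub_eq_zero.2 (mul_div_cancel₀ _ (fun h => hsP ((hφ0 s).1 h)))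
  · right
    intro p hp i
    let ψ : R →+* K := (φ.toRingHom.comp R.val.toRingHom).codRestrict K fun r => hSK r r.2
    have h0 : Polynomial.aeval (φ x) (p.map ψ) = 0 := by
      rw [← (hφ0 _).2 hp, Polynomial.aeval_def, Polynomial.eval₂_map, Polynomial.aeval_def]
      exact (Polynomial.hom_eval₂ p (algebraMap R A) φ.toRingHom x).symm
    have h1 : p.map ψ = 0 := by
      by_contra hne
      exact hint (IsAlgebraic.isIntegral ⟨_, hne, h0⟩)
    have h2 := congrArg (fun q => ((q.coeff i : K) : L)) h1
    simp only [Polynomial.coeff_map, Polynomial.coeff_zero, ZeroMemClass.coe_zero] at h2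
    exact (hφ0 _).1 h2

/-- If an Ore variable `x` over a subalgebra `R` is a fraction of elements of `R` modulo two Poisson
primes with the same intersection with `R`, then it is the same fraction modulo both. -/
theorem mul_sub_mem_of_mul_sub_mem (D : Derivation k A A)
    {R : Subalgebra k A} (hRD : ∀ r ∈ R, D r ∈ R) (hR : ∀ r ∈ R, ∀ s ∈ R, pb k r s ∈ R)
    {x : A} {c : k} (hc : c ≠ 0) (hDx : D x = c • x) (hx : ∀ r ∈ R, pb k x r - D r * x ∈ R)
    {P P' : Ideal A} (hP : IsPoissonPrime k P) (hDP : ∀ a ∈ P, D a ∈ P)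
    (hP' : IsPoissonPrime k P') (hDP' : ∀ a ∈ P', D a ∈ P') (hPP' : ∀ r ∈ R, r ∈ P → r ∈ P')
    {s t s' t' : A} (hs : s ∈ R) (ht : t ∈ R) (hst : s * x - t ∈ P)
    (hs' : s' ∈ R) (ht' : t' ∈ R) (hsP' : s ∉ P') (hs'P' : s' ∉ P') (hst' : s' * x - t' ∈ P') :
    s * x - t ∈ P' := by
  have hPr' := hP'.1
  -- With y = t/s, `key` is s² times {x, r} - D(r) x = {y, r} - D(r) y, and `keyD` is s² times D(y)
  -- = c y. For r in `R` both are relations inside `R`, so they pass from `P` to `P'`.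
  have key : ∀ {Q : Ideal A}, IsPoissonPrime k Q → ∀ {s t : A}, s * x - t ∈ Q → ∀ r : A,
      s * D r * t + s * s * (pb k x r - D r * x) + t * pb k s r - s * pb k t r ∈ Q := by
    intro Q hQ s t h r
    have h1 : pb k (s * x - t) r ∈ Q := by
      rw [pb_skew]; exact neg_mem (hQ.2 _ _ h)
    rw [pb_sub_left, pb_mul_left] at h1
    have h2 := sub_mem (Q.mul_mem_left s h1) (Q.mul_mem_left (pb k s r + s * D r) h)
    convert h2 using 1
    ring
  have keyD : ∀ {Q : Ideal A}, (∀ a ∈ Q, D a ∈ Q) → ∀ {s t : A}, s * x - t ∈ Q →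
      s * D t - t * D s - algebraMap k A c * t * s ∈ Q := by
    intro Q hQ s t h
    have h1 := hQ _ h
    rw [map_sub, D.leibniz, hDx, smul_eq_mul, smul_eq_mul, Algebra.smul_def] at h1
    have h2 := sub_mem (Q.mul_mem_left (D s + s * algebraMap k A c) h) (Q.mul_mem_left s h1)
    convert h2 using 1
    ring
  have hD := hPP' _ (sub_mem (sub_mem (mul_mem hs (hRD _ ht)) (mul_mem ht (hRD _ hs)))
    (mul_mem (mul_mem (R.algebraMap_mem c) ht) hs)) (keyD hDP hst)
  have hD' := keyD hDP' hst'
  -- The difference of the two fractions is δ = w/(s s'). Below, `hpb` says {δ, r} = D(r) δ and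
  -- `hDw` says D(δ) = c δ, cleared of denominators.
  set w := s * t' - s' * t with hw
  have hwR : w ∈ R := sub_mem (mul_mem hs ht') (mul_mem hs' ht)
  have hpb : ∀ r ∈ R, pb k w r * (s * s') - w * pb k (s * s') r - D r * w * (s * s') ∈ P' := by
    intro r hr
    have h1 := hPP' _ (sub_mem (add_mem (add_mem (mul_mem (mul_mem hs (hRD _ hr)) ht)
      (mul_mem (mul_mem hs hs) (hx _ hr))) (mul_mem ht (hR _ hs _ hr)))
      (mul_mem hs (hR _ ht _ hr))) (key hP hst r)
    have h2 := sub_mem (P'.mul_mem_left (s' * s') h1) (P'.mul_mem_left (s * s) (key hP' hst' r))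
    convert h2 using 1
    rw [hw, pb_sub_left, pb_mul_left, pb_mul_left, pb_mul_left]
    ring
  have hDw : D w * (s * s') - w * D (s * s') - algebraMap k A c * w * (s * s') ∈ P' := by
    have h2 := sub_mem (P'.mul_mem_left (s * s) hD') (P'.mul_mem_left (s' * s') hD)
    convert h2 using 1
    rw [hw, map_sub]
    simp only [D.leibniz, smul_eq_mul]
    ring
  have hss : s * s' ∉ P' := fun h => (hPr'.mem_or_mem h).elim hsP' hs'P'
  -- Setting r = δ amounts to using r = s s' and r = w; together they give c δ² = 0 modulo `P'`.
  have h1 : pb k w (s * s') - D (s * s') * w ∈ P' := by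
    have h := hpb _ (mul_mem hs hs')
    rw [pb_self, mul_zero, sub_zero, ← sub_mul] at h
    exact (hPr'.mem_or_mem h).resolve_right hss
  have h2 := hpb w hwR
  rw [pb_self, pb_skew k (s * s')] at h2
  have h3 : algebraMap k A c * (w * w * (s * s')) ∈ P' := by
    have h := sub_mem (sub_mem (P'.mul_mem_left w h1) h2) (P'.mul_mem_left w hDw)
    convert h using 1
    ring
  rw [← Algebra.smul_def] at h3
  have h4 : w * w * (s * s') ∈ P' := ((P'.restrictScalars k).smul_mem_iff hc).1 h3
  have hwP : w ∈ P' := by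
    rcases hPr'.mem_or_mem h4 with h | h
    · exact (hPr'.mem_or_mem h).elim id id
    · exact (hss h).elim
  have h5 : s' * (s * x - t) ∈ P' := by
    have h := add_mem (P'.mul_mem_left s hst') hwP
    convert h using 1
    rw [hw]; ring
  exact (hPr'.mem_or_mem h5).resolve_left hs'P'

end PoissonAlgebra

theorem Algebra.derivation_mem_adjoin {k A : Type*} [CommRing k] [CommRing A] [Algebra k A]
    (D : Derivation k A A) {s : Set A} (h : ∀ a ∈ s, D a ∈ Algebra.adjoin k s) {a : A}
    (ha : a ∈ Algebra.adjoin k s) : D a ∈ Algebra.adjoin k s := by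
  induction ha using Algebra.adjoin_induction with
  | mem x hx => exact h x hx
  | algebraMap r => rw [D.map_algebraMap]; exact zero_mem _
  | add x y hx hy ihx ihy => rw [map_add]; exact add_mem ihx ihy
  | mul x y hx hy ihx ihy =>
    rw [D.leibniz, smul_eq_mul, smul_eq_mul]
    exact add_mem (mul_mem hx ihy) (mul_mem hy ihx)

/-! ### Counting the stable Poisson primes. -/

namespace PoissonAlgebra

open Algebra

variable {k A : Type*} [Field k] [CommRing A] [Algebra k A] {n : ℕ}

theorem exists_aeval_eq_of_mem_adjoin (x : Fin n → A) (i : Fin n) {a : A}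
    (ha : a ∈ adjoin k (x '' {l | l.val < i.val + 1})) :
    ∃ p : Polynomial (adjoin k (x '' {l | l.val < i.val})), Polynomial.aeval (x i) p = a := by
  have hle : adjoin k (x '' {l | l.val < i.val + 1}) ≤
      ((Polynomial.aeval (x i) : Polynomial (adjoin k (x '' {l | l.val < i.val})) →ₐ[_] A).range
        ).restrictScalars k := by
    refine adjoin_le ?_
    rintro _ ⟨l, hl, rfl⟩
    rcases (Nat.lt_succ_iff.1 hl).lt_or_eq with hlt | heq
    · exact ⟨Polynomial.C ⟨x l, subset_adjoin ⟨l, hlt, rfl⟩⟩, Polynomial.aeval_C _ _⟩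
    · obtain rfl := Fin.ext heq
      exact ⟨Polynomial.X, Polynomial.aeval_X _⟩
  exact hle ha

variable [PoissonAlgebra k A] {x : Fin n → A} {D : Fin n → Derivation k A A}

/-- As each D_i acts diagonally on the generators, condition 1 keeps the brackets of x_l with l < j
inside the algebra they generate; biderivations do the rest. -/
theorem pb_mem_adjoin (hDx : ∀ i j, ∃ c : k, D i (x j) = c • x j)
    (h : ∀ i j : Fin n, j < i → pb k (x i) (x j) - D i (x j) * x i ∈ adjoin k (x '' {l | l < i}))
    (j : ℕ) {a b : A} (ha : a ∈ adjoin k (x '' {l | l.val < j}))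
    (hb : b ∈ adjoin k (x '' {l | l.val < j})) : pb k a b ∈ adjoin k (x '' {l | l.val < j}) := by
  have hlt : ∀ i l : Fin n, i.val < j → l < i →
      pb k (x i) (x l) ∈ adjoin k (x '' {l | l.val < j}) := by
    intro i l hi hl
    obtain ⟨c, hc⟩ := hDx i l
    have h1 := h i l hl
    rw [hc] at h1
    have h2 : pb k (x i) (x l) - c • x l * x i ∈ adjoin k (x '' {l | l.val < j}) :=
      adjoin_mono (Set.image_mono fun m hm => (Fin.lt_def.1 hm).trans hi) h1
    have h3 : c • x l * x i ∈ adjoin k (x '' {l | l.val < j}) :=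
      mul_mem (Subalgebra.smul_mem _
        (subset_adjoin (Set.mem_image_of_mem x ((Fin.lt_def.1 hl).trans hi))) c)
        (subset_adjoin (Set.mem_image_of_mem x hi))
    have h4 := add_mem h2 h3
    rwa [sub_add_cancel] at h4
  have hgen : ∀ i : Fin n, i.val < j → ∀ b ∈ adjoin k (x '' {l | l.val < j}),
      pb k (x i) b ∈ adjoin k (x '' {l | l.val < j}) := by
    intro i hi b hb
    refine derivation_mem_adjoin (ham k (x i)) ?_ hb
    rintro _ ⟨l, hl, rfl⟩
    rw [ham_apply]
    rcases lt_trichotomy l i with hli | rfl | hil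
    · exact hlt i l hi hli
    · rw [pb_self]; exact zero_mem _
    · rw [pb_skew]; exact neg_mem (hlt l i hl hil)
  refine derivation_mem_adjoin (ham k a) ?_ hb
  rintro _ ⟨l, hl, rfl⟩
  rw [ham_apply, pb_skew]
  exact neg_mem (hgen l hl a ha)

/-- A bound for the number of Poisson primes stable under the derivations `D i` in an algebra generated by
iterated Ore variables `x i`. -/
theorem encard_poissonPrime_le [CharZero k] (hgen : adjoin k (Set.range x) = ⊤)
    (hDx : ∀ i j, ∃ c : k, D i (x j) = c • x j) (hDxx : ∀ i, ∃ c : k, c ≠ 0 ∧ D i (x i) = c • x i)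
    (h : ∀ i j : Fin n, j < i → pb k (x i) (x j) - D i (x j) * x i ∈ adjoin k (x '' {l | l < i})) :
    {P : Ideal A | IsPoissonPrime k P ∧ ∀ i, ∀ a ∈ P, D i a ∈ P}.encard ≤ 2 ^ n := by
  let R : ℕ → Subalgebra k A := fun j => adjoin k (x '' {l | l.val < j})
  -- `T P` records the indices i for which x_i is a fraction over R_i modulo `P`; it is the
  -- invariant that separates stable Poisson primes.
  let T : Ideal A → Set (Fin n) := fun P =>
    {i | ∃ s ∈ R i, s ∉ P ∧ ∃ t ∈ R i, s * x i - t ∈ P}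
  have hRD : ∀ (i : Fin n) (j : ℕ), ∀ r ∈ R j, D i r ∈ R j := by
    intro i j r hr
    refine derivation_mem_adjoin (D i) ?_ hr
    rintro _ ⟨l, hl, rfl⟩
    obtain ⟨c, hc⟩ := hDx i l
    rw [hc]
    exact Subalgebra.smul_mem _ (subset_adjoin (Set.mem_image_of_mem x hl)) c
  have hR : ∀ (j : ℕ), ∀ r ∈ R j, ∀ s ∈ R j, pb k r s ∈ R j :=
    fun j r hr s hs => pb_mem_adjoin hDx h j hr hs
  have hx : ∀ i : Fin n, ∀ r ∈ R i, pb k (x i) r - D i r * x i ∈ R i := by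
    intro i r hr
    -- {x_i, -} - x_i D_i is a derivation, so condition 1 on the generators extends to all of R_i.
    have h1 := derivation_mem_adjoin (ham k (x i) - x i • D i) (s := x '' {l | l.val < i.val})
      (by
        rintro _ ⟨l, hl, rfl⟩
        rw [Derivation.sub_apply, Derivation.smul_apply, smul_eq_mul, mul_comm]
        exact h i l hl) hr
    rwa [Derivation.sub_apply, Derivation.smul_apply, smul_eq_mul, mul_comm] at h1
  have step : ∀ {P P' : Ideal A}, (IsPoissonPrime k P ∧ ∀ i, ∀ a ∈ P, D i a ∈ P) →
      (IsPoissonPrime k P' ∧ ∀ i, ∀ a ∈ P', D i a ∈ P') → T P = T P' → ∀ i : Fin n,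
      (∀ a ∈ R i, a ∈ P ↔ a ∈ P') → ∀ a ∈ R (i.val + 1), a ∈ P → a ∈ P' := by
    intro P P' hP hP' hT i hi a ha haP
    obtain ⟨p, rfl⟩ := exists_aeval_eq_of_mem_adjoin x i ha
    obtain ⟨c, hc, hcx⟩ := hDxx i
    by_cases hiT : i ∈ T P
    · have hiT' : i ∈ T P' := hT ▸ hiT
      obtain ⟨s, hs, hsP, t, ht, hst⟩ := hiT
      obtain ⟨s', hs', hsP', t', ht', hst'⟩ := hiT'
      have hsP'' : s ∉ P' := fun h => hsP ((hi s hs).2 h)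
      exact aeval_mem_of_mul_sub_mem hP'.1.1 (fun r hr => (hi r hr).1) hs ht hsP'' hst
        (mul_sub_mem_of_mul_sub_mem (D i) (hRD i i) (hR i) hc hcx (hx i) hP.1 (hP.2 i) hP'.1
          (hP'.2 i) (fun r hr => (hi r hr).1) hs ht hst hs' ht' hsP'' hsP' hst') p haP
    · have hcoeff := (exists_mul_sub_mem_or_transcendental (D i) (hRD i i) (hR i) hc hcx (hx i)
        hP.1 (hP.2 i)).resolve_left hiT p haP
      rw [Polynomial.aeval_eq_sum_range]
      exact sum_mem fun m _ => P'.mul_mem_right _ ((hi _ (p.coeff m).2).1 (hcoeff m))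
  have hinj : Set.InjOn T {P : Ideal A | IsPoissonPrime k P ∧ ∀ i, ∀ a ∈ P, D i a ∈ P} := by
    intro P hP P' hP' hT
    have hall : ∀ j : ℕ, j ≤ n → ∀ a ∈ R j, a ∈ P ↔ a ∈ P' := by
      intro j
      induction j with
      | zero =>
        -- R_0 is the base field, which meets every prime in 0.
        intro _ a ha
        simp only [R, Nat.not_lt_zero, Set.ofPred_false, Set.image_empty, adjoin_empty,
          mem_bot] at ha
        obtain ⟨c, rfl⟩ := ha
        have hc : ∀ {Q : Ideal A}, Q.IsPrime → (algebraMap k A c ∈ Q ↔ c = 0) := by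
          refine fun {Q} hQ => ⟨fun hcQ => ?_, fun hc => by simp [hc]⟩
          by_contra hc
          exact hQ.ne_top (Ideal.eq_top_of_isUnit_mem _ hcQ ((IsUnit.mk0 c hc).map _))
        rw [hc hP.1.1, hc hP'.1.1]
      | succ j ih =>
        intro hj a ha
        have hj' := ih (by omega)
        exact ⟨step hP hP' hT ⟨j, hj⟩ hj' a ha,
          step hP' hP hT.symm ⟨j, hj⟩ (fun a ha => (hj' a ha).symm) a ha⟩
    have htop : R n = ⊤ := by
      have huniv : {l : Fin n | l.val < n} = Set.univ := Set.eq_univ_of_forall fun l => l.2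
      simp only [R, huniv, Set.image_univ, hgen]
    exact Ideal.ext fun a => hall n le_rfl a (htop ▸ mem_top)
  refine (Set.encard_le_encard_of_injOn (Set.mapsTo_univ T _) hinj).trans_eq ?_
  rw [Set.encard_univ, ENat.card_eq_coe_fintype_card, Fintype.card_set, Fintype.card_fin]
  norm_cast

end PoissonAlgebra

theorem theorem1p10 {k : Type*} [Field k] [CharZero k] {A : Type*} [CommRing A] [Algebra k A]
    [PoissonAlgebra k A] {r : ℕ} (ρ : (Fin r → kˣ) →* (A ≃ₐ[k] A))
    (hrat : TorusAction.IsRational ρ) (hpois : TorusAction.IsPoisson ρ)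
    {n : ℕ} (x : Fin n → A) (hx : ∀ i, TorusAction.IsEigenvector ρ (x i))
    (hgen : Algebra.adjoin k (Set.range x) = ⊤)
    (η : Fin n → (Fin r → k))
    (h1 : ∀ i j : Fin n, j < i →
      PoissonAlgebra.pb k (x i) (x j) - TorusAction.differential hrat (η i) (x j) * x i ∈
        Algebra.adjoin k (x '' {l | l < i}))
    (h2 : ∀ i, ∃ c : k, c ≠ 0 ∧
      Module.End.HasEigenvector (TorusAction.differential hrat (η i)) c (x i)) :
    {P : Ideal A | PoissonAlgebra.IsPoissonPrime k P ∧ TorusAction.IsStable ρ P}.encard ≤ 2 ^ n ∧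
      PoissonAlgebra.DixmierMoeglin k A := by
  have hcount : {P : Ideal A | PoissonAlgebra.IsPoissonPrime k P ∧
      TorusAction.IsStable ρ P}.encard ≤ 2 ^ n := by
    refine (Set.encard_le_encard ?_).trans (PoissonAlgebra.encard_poissonPrime_le
      (D := fun i => TorusAction.differentialDer hrat (η i)) hgen (fun i j => ?_) (fun i => ?_) h1)
    · exact fun P hP => ⟨hP.1, fun i a ha => hP.2.differential_mem hrat (η i) ha⟩
    · obtain ⟨m, hm⟩ := (hx j).exists_mem_weightSpace hrat
      exact ⟨_, TorusAction.differential_apply hrat (η i) hm⟩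
    · obtain ⟨c, hc, hcx⟩ := h2 i
      exact ⟨c, hc, hcx.apply_eq_smul⟩
  have : Algebra.FiniteType k A :=
    ⟨(Subalgebra.fg_def).2 ⟨Set.range x, Set.finite_range x, hgen⟩⟩
  exact ⟨hcount, TorusAction.dixmierMoeglin_of_finite hrat hpois
    (Set.finite_of_encard_le_coe (k := 2 ^ n) (by exact_mod_cast hcount))⟩
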